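/- **Theorem (Shimizu–Leutbecher).** Let $\mathbb D^*=\{z\in\mathbb C: 0<|z|<1\}$ carry its complete hyperbolic metric $ds^2=\bigl(\frac{-1}{|z|\log|z|}\bigr)^2|dz|^2$ (the metric for which $z\mapsto e^{2\pi i z}$ is a local isometry from the hyperbolic plane $\mathbb H^2$ onto $\mathbb D^*$), and for $0<r<1$ let $\mathcal B_r=\{z\in\mathbb D^*:|z|<r\}$. Let $S$ be a complete hyperbolic Riemann surface, that is, a connected Riemann surface with a complete (conformal) metric locally isometric to $\mathbb H^2$; the area of $S$ may be infinite. A *horocyclic neighbourhood* in $S$ is a subset $\mathcal U\subseteq S$ which is the image of a conformal Riemannian isometry $\mathcal B_r\to\mathcal U$ for some $0<r<1$; its area is $\mathrm{area}(\mathcal U)=\mathrm{area}(\mathcal B_r)=\int_{\mathcal B_r}\frac{|dz|^2}{(|z|\log|z|)^2}$, where $|dz|^2$ denotes Lebesgue measure. A *cusp* of $S$ is a class of horocyclic neighbourhoods under the equivalence relation generated by relating two of them whenever both contain a common horocyclic neighbourhood, and the members of the class are called the horocyclic neighbourhoods of the cusp. Then the cusps of $S$ are $\ge 1$: one can choose for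 every cusp $P$ of $S$ (finitely or infinitely many) a horocyclic neighbourhood $\mathcal U_P$ of $P$ such that $\mathcal U_P\cap\mathcal U_Q=\emptyset$ for $P\neq Q$ and $\mathrm{area}(\mathcal U_P)\ge 1$ for all $P$. -/

import Mathlib

open scoped Manifold ContDiff Topology ENNReal UpperHalfPlane

/-- The metric of the Riemann surface `S` is a hyperbolic metric: the distance is the infimum of
the lengths of paths, and every point is the centre of a ball that a holomorphic isometry maps
onto a ball of the hyperbolic plane. -/
structure IsHyperbolicMetric (S : Type*) [MetricSpace S] [ChartedSpace ℂ S] : Prop where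
  edist_eq_iInf_length : ∀ x y : S, edist x y = ⨅ γ : Path x y, eVariationOn γ Set.univ
  exists_isometry_ball : ∀ x : S, ∃ ε > 0, ∃ f : S → ℍ,
    f '' Metric.ball x ε = Metric.ball (f x) ε ∧
    MDifferentiableOn 𝓘(ℂ) 𝓘(ℂ) f (Metric.ball x ε) ∧
    ∀ y ∈ Metric.ball x ε, ∀ z ∈ Metric.ball x ε, dist (f y) (f z) = dist y z

/-- The punctured disk `{z : 0 < |z| < r}`, as a subset of `ℂ`. -/
def puncturedDisk (r : ℝ) : Set ℂ :=
  {z | 0 < ‖z‖ ∧ ‖z‖ < r}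

/-- The covering `z ↦ exp (2πiz)` of the punctured unit disk by the hyperbolic plane. The complete
hyperbolic metric of the punctured unit disk is the one for which it is a local isometry. -/
noncomputable def puncturedDiskCover (z : ℍ) : ℂ :=
  Complex.exp (2 * Real.pi * Complex.I * z)

/-- The density of the complete hyperbolic metric `(-1 / (|z| log |z|))² |dz|²` of the punctured
unit disk. -/
noncomputable def puncturedDiskDensity (z : ℂ) : ℝ :=
  -1 / (‖z‖ * Real.log ‖z‖)

/-- The hyperbolic area of a subset of the punctured unit disk. -/
noncomputable def puncturedDiskArea (A : Set ℂ) : ℝ≥0∞ :=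
  ∫⁻ z in A, ENNReal.ofReal (puncturedDiskDensity z ^ 2)

/-- A horocyclic neighbourhood in `S`: a (conformal) Riemannian isometry `toFun` from the punctured
disk `{z : 0 < |z| < r}`, `0 < r < 1`, with the hyperbolic metric of the punctured unit disk, onto
a subset of `S`. The values of `toFun` outside this punctured disk play no role. -/
structure HorocyclicNhd (S : Type*) [MetricSpace S] [ChartedSpace ℂ S] where
  radius : ℝ
  radius_pos : 0 < radius
  radius_lt_one : radius < 1
  toFun : ℂ → S
  injOn : Set.InjOn toFun (puncturedDisk radius)
  holomorphic : MDifferentiableOn 𝓘(ℂ) 𝓘(ℂ) toFun (puncturedDisk radius)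
  local_isometry : ∀ z : ℍ, puncturedDiskCover z ∈ puncturedDisk radius → ∃ V ∈ 𝓝 z,
    ∀ w ∈ V, ∀ w' ∈ V,
      dist (toFun (puncturedDiskCover w)) (toFun (puncturedDiskCover w')) = dist w w'

namespace HorocyclicNhd

variable {S : Type*} [MetricSpace S] [ChartedSpace ℂ S]

/-- The underlying subset of `S`. -/
def carrier (U : HorocyclicNhd S) : Set S :=
  U.toFun '' puncturedDisk U.radius

/-- The area of a horocyclic neighbourhood, which is that of the isometric punctured disk. -/
noncomputable def area (U : HorocyclicNhd S) : ℝ≥0∞ :=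
  puncturedDiskArea (puncturedDisk U.radius)

/-- Two horocyclic neighbourhoods belong to the same cusp if they contain a common one. -/
def SameCusp (U V : HorocyclicNhd S) : Prop :=
  ∃ W : HorocyclicNhd S, W.carrier ⊆ U.carrier ∩ V.carrier

end HorocyclicNhd

/-- A cusp of `S`, as a class of horocyclic neighbourhoods. -/
def Cusp (S : Type*) [MetricSpace S] [ChartedSpace ℂ S] : Type _ :=
  Quot (HorocyclicNhd.SameCusp (S := S))

/-- `U` is a horocyclic neighbourhood of the cusp `P`. -/
def HorocyclicNhd.IsNhdOf {S : Type*} [MetricSpace S] [ChartedSpace ℂ S]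
    (U : HorocyclicNhd S) (P : Cusp S) : Prop :=
  Quot.mk _ U = P

/-- The cusps of `S` are `≥ c`: they have pairwise disjoint horocyclic neighbourhoods of
area `≥ c`. -/
def CuspsAtLeast (S : Type*) [MetricSpace S] [ChartedSpace ℂ S] (c : ℝ≥0∞) : Prop :=
  ∃ U : Cusp S → HorocyclicNhd S,
    (∀ P, (U P).IsNhdOf P) ∧
    (∀ P Q, P ≠ Q → Disjoint (U P).carrier (U Q).carrier) ∧
    ∀ P, c ≤ (U P).area

/-! Lift a horocyclic neighbourhood of a cusp through `puncturedDiskCover`. The result is a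
holomorphic local isometry into `S`, defined on a half-plane high up in `ℍ` and invariant under z ↦
z + 1. Since `S` is complete, it continues to a local isometry F on all of `ℍ`
(`exists_holIsomAt_extension`), and the periodicity persists by the identity theorem. Such
developing maps are rigid: if F z = G w, then F = G ∘ g for some g in SL(2, ℝ) with g z = w
(`exists_smul_of_apply_eq`). This replaces covering space theory and the discreteness of a Fuchsian
group. The elements g with F ∘ g = F play the role of the group, and local injectivity of F plays
the role of discreteness. Let c be the lower left entry of g, and T the translation by 1. The
conjugate g T g⁻¹ preserves G and has lower left entry -c², so Shimizu's lemma gives c = 0 or c² ≥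
1. In the second case Im (g z) ≤ 1 / (c² Im z), so z and g z cannot both lie above height 1
(`lower_left_eq_zero`). Thus, if the images of {Im > 1} under F and G meet, g fixes ∞ and the two
cusps coincide. For F = G, g is moreover an integer translation, because the given neighbourhood is
embedded. So {Im > 1} modulo integer translations embeds for each cusp, and different cusps have
disjoint images. This region is the punctured disk of radius exp(-2π), whose area is 2π · (1 / 2π) =
1. -/

open Filter Set
open scoped MatrixGroups

/-! ### Holomorphic isometry germs fixing a point, in the Cayley coordinate. -/

namespace UpperHalfPlane

theorem sl_denom_ne_zero (g : SL(2, ℝ)) (z : ℍ) : (g 1 0 : ℂ) * z + g 1 1 ≠ 0 :=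
  denom_ne_zero (g : GL (Fin 2) ℝ) z

theorem coe_sl_smul (g : SL(2, ℝ)) (z : ℍ) :
    ((g • z : ℍ) : ℂ) = ((g 0 0 : ℂ) * z + g 0 1) / ((g 1 0 : ℂ) * z + g 1 1) :=
  coe_specialLinearGroup_apply g z

theorem mdifferentiable_sl_smul (g : SL(2, ℝ)) :
    MDifferentiable 𝓘(ℂ) 𝓘(ℂ) (fun z : ℍ => g • z) :=
  mdifferentiable_smul (g := Matrix.SpecialLinearGroup.mapGL ℝ g) (by simp)

theorem coe_add_I_ne_zero (u : ℍ) : (u : ℂ) + Complex.I ≠ 0 := by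
  intro h0
  have := congrArg Complex.im h0
  simp at this
  linarith [u.im_pos]

/-- The Cayley coordinate of `z` determines `z`. -/
theorem eq_of_cayley_eq {z w : ℍ}
    (h : ((z : ℂ) - Complex.I) / (z + Complex.I) = ((w : ℂ) - Complex.I) / (w + Complex.I)) :
    z = w := by
  rw [div_eq_div_iff (coe_add_I_ne_zero z) (coe_add_I_ne_zero w)] at h
  have h2 : (2 * Complex.I) * ((z : ℂ) - w) = 0 := by linear_combination h
  have : (z : ℂ) - w = 0 := by simpa using h2
  exact UpperHalfPlane.ext (sub_eq_zero.mp this)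

theorem norm_cayley (z : ℍ) :
    ‖((z : ℂ) - Complex.I) / (z + Complex.I)‖ = Real.tanh (dist z I / 2) := by
  rw [tanh_half_dist, norm_div, Complex.dist_eq, Complex.dist_eq]
  simp

/-- The rotation of the hyperbolic plane about `I`. -/
noncomputable def rotation (θ : ℝ) : SL(2, ℝ) :=
  ⟨!![Real.cos θ, Real.sin θ; -Real.sin θ, Real.cos θ], by
    rw [Matrix.det_fin_two_of]; linear_combination Real.cos_sq_add_sin_sq θ⟩

theorem cayley_rotation_smul (θ : ℝ) (z : ℍ) :
    (((rotation θ • z : ℍ) : ℂ) - Complex.I) / (((rotation θ • z : ℍ) : ℂ) + Complex.I) =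
      Complex.exp (2 * θ * Complex.I) * (((z : ℂ) - Complex.I) / (z + Complex.I)) := by
  have hz := coe_add_I_ne_zero z
  have hd : (-(Real.sin θ : ℂ)) * z + Real.cos θ ≠ 0 := by
    simpa [rotation] using sl_denom_ne_zero (rotation θ) z
  have hw := coe_add_I_ne_zero (rotation θ • z)
  have hcoe : ((rotation θ • z : ℍ) : ℂ) =
      ((Real.cos θ : ℂ) * z + Real.sin θ) / (-(Real.sin θ : ℂ) * z + Real.cos θ) := by
    rw [coe_sl_smul]; simp [rotation]
  rw [hcoe] at hw ⊢
  have h2 : Complex.exp (2 * θ * Complex.I) =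
      (Real.cos θ + Real.sin θ * Complex.I) ^ 2 := by
    rw [Complex.ofReal_cos, Complex.ofReal_sin, ← Complex.exp_mul_I, ← Complex.exp_nat_mul]
    congr 1; push_cast; ring
  have hcs : (Real.cos θ : ℂ) ^ 2 + (Real.sin θ : ℂ) ^ 2 = 1 := by
    exact_mod_cast Real.cos_sq_add_sin_sq θ
  rw [h2, mul_div_assoc', div_eq_div_iff hw hz]
  generalize (Real.cos θ : ℂ) = c at *
  generalize (Real.sin θ : ℂ) = s at *
  have hI : Complex.I ^ 2 = -1 := Complex.I_sq
  have e1 : (c * z + s) / (-s * z + c) - Complex.I =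
      (c + s * Complex.I) * (z - Complex.I) / (-s * z + c) := by
    rw [eq_div_iff hd, sub_mul, div_mul_cancel₀ _ hd]
    linear_combination s * hI
  have e2 : (c * z + s) / (-s * z + c) + Complex.I =
      (c - s * Complex.I) * (z + Complex.I) / (-s * z + c) := by
    rw [eq_div_iff hd, add_mul, div_mul_cancel₀ _ hd]
    linear_combination s * hI
  have e3 : (c + s * Complex.I) * (c - s * Complex.I) = 1 := by
    linear_combination hcs - s ^ 2 * hI
  rw [e1, e2]
  linear_combination
    (-(c + s * Complex.I) * (z - Complex.I) * (z + Complex.I) / (-s * z + c)) * e3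

/-- A Schwarz lemma argument: in the Cayley coordinate the modulus is tanh of half the distance to
`I`. The quotient of the coordinates of h z and z therefore has modulus 1, and the maximum principle
makes it constant. -/
theorem exists_smul_eventuallyEq_of_apply_I {h : ℍ → ℍ}
    (hd : ∀ᶠ z in 𝓝 I, MDifferentiableAt 𝓘(ℂ) 𝓘(ℂ) h z)
    (hiso : ∀ᶠ z in 𝓝 I, dist (h z) I = dist z I) :
    ∃ g : SL(2, ℝ), h =ᶠ[𝓝 I] (g • ·) := by
  have hev : ∀ᶠ z in 𝓝 ((I : ℍ) : ℂ), ∃ u : ℍ, (u : ℂ) = z ∧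
      MDifferentiableAt 𝓘(ℂ) 𝓘(ℂ) h u ∧ dist (h u) I = dist u I := by
    rw [← isOpenEmbedding_coe.map_nhds_eq, eventually_map]
    filter_upwards [hd, hiso] with u h1 h2 using ⟨u, rfl, h1, h2⟩
  obtain ⟨ρ, hρ, hball⟩ := Metric.eventually_nhds_iff_ball.mp hev
  set A : ℂ → ℂ := fun z => ((h (ofComplex z) : ℂ) - Complex.I) / (h (ofComplex z) + Complex.I)
    with hA
  have hAd : DifferentiableOn ℂ A (Metric.ball (I : ℂ) ρ) := by
    intro z hz
    obtain ⟨u, rfl, hu, -⟩ := hball z hz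
    have h1 : DifferentiableAt ℂ ((fun w : ℍ => (h w : ℂ)) ∘ ofComplex) u :=
      mdifferentiableAt_iff.mp ((mdifferentiable_coe _).comp u hu)
    refine DifferentiableAt.differentiableWithinAt ?_
    exact (h1.sub_const _).div (h1.add_const _) (coe_add_I_ne_zero _)
  have hAn : ∀ u : ℍ, (u : ℂ) ∈ Metric.ball (I : ℂ) ρ →
      ‖A u‖ = ‖((u : ℂ) - Complex.I) / (u + Complex.I)‖ := by
    intro u hu
    obtain ⟨v, hv, -, h2⟩ := hball u hu
    obtain rfl : v = u := UpperHalfPlane.ext hv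
    simp only [hA, ofComplex_apply, norm_cayley, h2]
  have hIb : (I : ℂ) ∈ Metric.ball (I : ℂ) ρ := Metric.mem_ball_self hρ
  have hAI : A I = 0 := by
    have := hAn I hIb
    simpa using this
  -- This is the quotient of `A` by the Cayley coordinate, with its singularity at `I` removed.
  set D : ℂ → ℂ := fun z => dslope A I z * (z + Complex.I) with hD
  have hDd : DifferentiableOn ℂ D (Metric.ball (I : ℂ) ρ) :=
    ((Complex.differentiableOn_dslope (Metric.ball_mem_nhds _ hρ)).mpr hAd).mul
      (differentiableOn_id.add_const _)
  have hDA : ∀ u : ℍ, A u = D u * (((u : ℂ) - Complex.I) / (u + Complex.I)) := by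
    intro u
    have h1 := sub_smul_dslope A I u
    rw [hAI, sub_zero, smul_eq_mul, coe_I] at h1
    rw [← h1, hD]
    field_simp [coe_add_I_ne_zero u]
    simp
  have hDn' : ∀ z ∈ Metric.ball (I : ℂ) ρ, z ≠ I → ‖D z‖ = 1 := by
    intro z hz hzI
    obtain ⟨u, rfl, -⟩ := hball z hz
    have h1 := hAn u hz
    rw [hDA, norm_mul] at h1
    have h2 : ‖((u : ℂ) - Complex.I) / (u + Complex.I)‖ ≠ 0 := by
      rw [norm_ne_zero_iff]
      exact div_ne_zero (sub_ne_zero.mpr hzI) (coe_add_I_ne_zero u)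
    exact mul_right_cancel₀ h2 (by rw [h1, one_mul])
  have hDI : ‖D I‖ = 1 := by
    have hc : ContinuousAt (fun z => ‖D z‖) I :=
      (hDd.continuousOn.continuousAt (Metric.ball_mem_nhds _ hρ)).norm
    have h1 : Tendsto (fun z => ‖D z‖) (𝓝[≠] (I : ℂ)) (𝓝 ‖D I‖) := hc.mono_left nhdsWithin_le_nhds
    have h2 : Tendsto (fun z => ‖D z‖) (𝓝[≠] (I : ℂ)) (𝓝 1) := by
      refine tendsto_const_nhds.congr' ?_
      filter_upwards [self_mem_nhdsWithin,
        mem_nhdsWithin_of_mem_nhds (Metric.ball_mem_nhds (I : ℂ) hρ)] with z hz hz'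
      exact (hDn' z hz' hz).symm
    exact tendsto_nhds_unique h1 h2
  have hDn : ∀ z ∈ Metric.ball (I : ℂ) ρ, ‖D z‖ = 1 := fun z hz => by
    by_cases hzI : z = I
    · rw [hzI, hDI]
    · exact hDn' z hz hzI
  have hconst : EqOn D (Function.const ℂ (D I)) (Metric.ball (I : ℂ) ρ) := by
    refine Complex.eqOn_of_isPreconnected_of_isMaxOn_norm
      (convex_ball _ _).isPreconnected Metric.isOpen_ball hDd hIb ?_
    intro z hz
    simp only [mem_ofPred_eq, Function.comp_apply, hDn z hz, hDI, le_refl]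
  obtain ⟨θ, hθ⟩ := (Complex.norm_eq_one_iff _).mp hDI
  -- The angle is halved because `rotation θ` multiplies the Cayley coordinate by exp(2iθ).
  refine ⟨rotation (θ / 2), ?_⟩
  have hnear : ∀ᶠ u : ℍ in 𝓝 I, (u : ℂ) ∈ Metric.ball (I : ℂ) ρ :=
    continuous_coe.continuousAt.eventually (Metric.ball_mem_nhds _ hρ)
  filter_upwards [hnear] with u hu
  refine eq_of_cayley_eq ?_
  have h1 := hDA u
  rw [hconst hu, Function.const_apply, ← hθ] at h1
  rw [cayley_rotation_smul]
  simp only [hA, ofComplex_apply] at h1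
  rw [h1]
  congr 2
  push_cast; ring

end UpperHalfPlane

/-! ### Germs of holomorphic isometries and their rigidity. -/

/-- A map between Riemann surfaces with metrics which near `z` is holomorphic and isometric. -/
structure HolIsomAt {M N : Type*} [MetricSpace M] [ChartedSpace ℂ M] [MetricSpace N]
    [ChartedSpace ℂ N] (F : M → N) (z : M) : Prop where
  isom : ∃ V ∈ 𝓝 z, ∀ w ∈ V, ∀ w' ∈ V, dist (F w) (F w') = dist w w'
  hol : ∀ᶠ w in 𝓝 z, MDifferentiableAt 𝓘(ℂ) 𝓘(ℂ) F w

namespace HolIsomAt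

variable {M N P : Type*} [MetricSpace M] [ChartedSpace ℂ M] [MetricSpace N]
    [ChartedSpace ℂ N] [MetricSpace P] [ChartedSpace ℂ P] {F G : M → N} {z : M}

theorem mdifferentiableAt (hF : HolIsomAt F z) : MDifferentiableAt 𝓘(ℂ) 𝓘(ℂ) F z :=
  hF.hol.self_of_nhds

theorem continuousAt (hF : HolIsomAt F z) : ContinuousAt F z :=
  hF.mdifferentiableAt.continuousAt

theorem eventually (hF : HolIsomAt F z) : ∀ᶠ w in 𝓝 z, HolIsomAt F w := by
  obtain ⟨V, hV, h⟩ := hF.isom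
  filter_upwards [eventually_mem_nhds_iff.mpr hV, hF.hol.eventually_nhds] with w h1 h2
  exact ⟨⟨V, h1, h⟩, h2⟩

theorem congr (hF : HolIsomAt F z) (h : F =ᶠ[𝓝 z] G) : HolIsomAt G z := by
  obtain ⟨V, hV, hi⟩ := hF.isom
  refine ⟨⟨V ∩ {w | F w = G w}, inter_mem hV h, fun w hw w' hw' => ?_⟩, ?_⟩
  · have e1 : F w = G w := hw.2
    have e2 : F w' = G w' := hw'.2
    rw [← e1, ← e2, hi w hw.1 w' hw'.1]
  · filter_upwards [hF.hol, h.eventually_nhds] with w h1 h2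
    exact h1.congr_of_eventuallyEq (EventuallyEq.symm h2)

theorem comp {H : N → P} (hH : HolIsomAt H (F z)) (hF : HolIsomAt F z) :
    HolIsomAt (fun w => H (F w)) z := by
  obtain ⟨V, hV, hi⟩ := hF.isom
  obtain ⟨W, hW, hj⟩ := hH.isom
  refine ⟨⟨V ∩ F ⁻¹' W, inter_mem hV (hF.continuousAt hW), fun w hw w' hw' => ?_⟩, ?_⟩
  · rw [hj _ hw.2 _ hw'.2, hi _ hw.1 _ hw'.1]
  · filter_upwards [hF.hol, hF.continuousAt.eventually hH.hol] with w h1 h2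
    exact h2.comp w h1

end HolIsomAt

namespace UpperHalfPlane

theorem holIsomAt_smul (g : SL(2, ℝ)) (z : ℍ) : HolIsomAt (fun w : ℍ => g • w) z :=
  ⟨⟨univ, univ_mem, fun w _ w' _ => dist_smul g w w'⟩,
    Eventually.of_forall fun w => mdifferentiable_sl_smul g w⟩

/-- Transitivity of SL(2, ℝ) on `ℍ` reduces this to a germ fixing `I`. -/
theorem exists_smul_of_holIsomAt {h : ℍ → ℍ} {p : ℍ} (hh : HolIsomAt h p) :
    ∃ g : SL(2, ℝ), h =ᶠ[𝓝 p] (g • ·) := by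
  set a := p.toSL2R
  set b := (h p).toSL2R
  have ha : a • I = p := toSL2R_smul_I p
  have hb : b • I = h p := toSL2R_smul_I (h p)
  have h1 : HolIsomAt (fun w => b⁻¹ • h (a • w)) I :=
    (holIsomAt_smul b⁻¹ _).comp (HolIsomAt.comp (by rwa [ha]) (holIsomAt_smul a I))
  have hI : b⁻¹ • h (a • I) = I := by rw [ha, ← hb, inv_smul_smul]
  obtain ⟨V, hV, hi⟩ := h1.isom
  obtain ⟨g, hg⟩ := exists_smul_eventuallyEq_of_apply_I h1.hol (by
    filter_upwards [hV] with w hw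
    conv_lhs => rw [← hI]
    exact hi w hw I (mem_of_mem_nhds hV))
  refine ⟨b * g * a⁻¹, ?_⟩
  have hca : Tendsto (fun w : ℍ => a⁻¹ • w) (𝓝 p) (𝓝 I) := by
    have h2 := (holIsomAt_smul a⁻¹ p).continuousAt
    rwa [ContinuousAt, ← ha, inv_smul_smul, ha] at h2
  filter_upwards [hca.eventually hg] with w hw
  rw [smul_inv_smul, inv_smul_eq_iff] at hw
  rw [hw, mul_smul, mul_smul]

instance (p : ℍ) : NeBot (𝓝[≠] p) := by
  rw [neBot_iff, Ne, ← isOpen_singleton_iff_punctured_nhds]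
  intro h
  have := isOpenEmbedding_coe.isOpenMap _ h
  rw [image_singleton] at this
  exact not_isOpen_singleton _ this

theorem smul_eq_smul_of_eventually {g₁ g₂ : SL(2, ℝ)} {p : ℍ}
    (h : ∀ᶠ z in 𝓝 p, g₁ • z = g₂ • z) (z : ℍ) : g₁ • z = g₂ • z := by
  have h0 : (fun z : ℍ => ((g₁ • z : ℍ) : ℂ) - (g₂ • z : ℍ)) = 0 := by
    refine eq_zero_of_frequently (τ := p) (fun w => ?_) ?_
    · exact ((mdifferentiable_coe _).comp w (mdifferentiable_sl_smul g₁ w)).sub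
        ((mdifferentiable_coe _).comp w (mdifferentiable_sl_smul g₂ w))
    · refine Eventually.frequently ?_
      filter_upwards [h.filter_mono nhdsWithin_le_nhds] with w hw
      rw [hw, sub_self]
  exact UpperHalfPlane.ext (sub_eq_zero.mp (congrFun h0 z))

end UpperHalfPlane

/-- A continuous local inverse of a holomorphic function is holomorphic. -/
theorem Complex.differentiableAt_of_local_inverse {f k : ℂ → ℂ} {u : ℂ}
    (hf : ∀ᶠ v in 𝓝 u, DifferentiableAt ℂ f v) (hk : ∀ᶠ w in 𝓝 (f u), ContinuousAt k w)
    (hfk : ∀ᶠ w in 𝓝 (f u), f (k w) = w) (hkf : ∀ᶠ v in 𝓝 u, k (f v) = v) :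
    DifferentiableAt ℂ k (f u) := by
  have hku : k (f u) = u := hkf.self_of_nhds
  have hfa : AnalyticAt ℂ f u := Complex.analyticAt_iff_eventually_differentiableAt.mpr hf
  rcases hfa.deriv.eventually_eq_zero_or_eventually_ne_zero with h0 | h0
  -- If the derivative vanished near u, f would be locally constant, contradicting the local left
  -- inverse.
  · exfalso
    obtain ⟨ρ, hρ, hb⟩ := Metric.eventually_nhds_iff_ball.mp (h0.and (hf.and hkf))
    have hconst : ∀ v ∈ Metric.ball u ρ, v = u := by
      intro v hv
      have h1 : f v = f u := Metric.isOpen_ball.is_const_of_deriv_eq_zero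
        (convex_ball u ρ).isPreconnected
        (fun w hw => (hb w hw).2.1.differentiableWithinAt) (fun w hw => (hb w hw).1) hv
        (Metric.mem_ball_self hρ)
      rw [← (hb v hv).2.2, h1, hku]
    have hsing : ({u} : Set ℂ) = Metric.ball u ρ :=
      Subset.antisymm (singleton_subset_iff.mpr (Metric.mem_ball_self hρ)) hconst
    exact not_isOpen_singleton u (hsing ▸ Metric.isOpen_ball)
  · have hkc : Tendsto k (𝓝 (f u)) (𝓝 u) := by
      have := hk.self_of_nhds
      rwa [ContinuousAt, hku] at this
    -- Nonvanishing of the derivative at u itself is not needed: k is differentiable off f u and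
    -- continuous there, so the singularity is removable.
    refine (analyticAt_of_differentiable_on_punctured_nhds_of_continuousAt ?_
      hk.self_of_nhds).differentiableAt
    rw [eventually_nhdsWithin_iff] at h0 ⊢
    filter_upwards [hkc.eventually h0, hkc.eventually hf, hk, hfk.eventually_nhds]
      with w h1 h2 h3 h4 hw
    have hne : k w ≠ u := fun h => hw (by rw [← h4.self_of_nhds, h]; rfl)
    exact (h2.hasDerivAt.of_local_left_inverse h3 (h1 hne) h4).differentiableAt

/-! ### Local models of the surface and the identity theorem for developing maps. -/

namespace IsHyperbolicMetric

variable {S : Type*} [MetricSpace S] [ChartedSpace ℂ S] [IsManifold 𝓘(ℂ) ω S]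

/-- The map k inverts the isometry f of a ball about x. For any germ F landing in this ball, f ∘ F
is an isometry germ of `ℍ`, hence some g, so F = k ∘ g: every developing map is locally k up to
SL(2, ℝ). -/
theorem exists_parametrization (hS : IsHyperbolicMetric S) (x : S) :
    ∃ ε > 0, ∃ (p : ℍ) (k : ℍ → S), (∀ w ∈ Metric.ball p ε, HolIsomAt k w) ∧
      (∀ w ∈ Metric.ball p ε, ∀ w' ∈ Metric.ball p ε, dist (k w) (k w') = dist w w') ∧ k p = x ∧
      ∀ (F : ℍ → S) (z : ℍ), HolIsomAt F z → F z ∈ Metric.ball x ε →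
        ∃ g : SL(2, ℝ), g • z ∈ Metric.ball p ε ∧ F =ᶠ[𝓝 z] fun u => k (g • u) := by
  have : IsManifold 𝓘(ℂ) 1 S := IsManifold.of_le (n := ω) le_top
  obtain ⟨ε, hε, f, himg, hfd, hfi⟩ := hS.exists_isometry_ball x
  have hx : x ∈ Metric.ball x ε := Metric.mem_ball_self hε
  have hinj : InjOn f (Metric.ball x ε) := fun y hy z hz h => by
    rw [← dist_eq_zero, ← hfi y hy z hz, h, dist_self]
  have : Nonempty S := ⟨x⟩
  set k : ℍ → S := Function.invFunOn f (Metric.ball x ε)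
  have hkm : ∀ w ∈ Metric.ball (f x) ε, k w ∈ Metric.ball x ε := fun w hw =>
    Function.invFunOn_mem (by rwa [← himg] at hw)
  have hfk : ∀ w ∈ Metric.ball (f x) ε, f (k w) = w := fun w hw =>
    Function.invFunOn_eq (by rwa [← himg] at hw)
  have hfm : ∀ y ∈ Metric.ball x ε, f y ∈ Metric.ball (f x) ε := fun y hy =>
    himg ▸ mem_image_of_mem f hy
  have hkf : ∀ y ∈ Metric.ball x ε, k (f y) = y := fun y hy => hinj.leftInvOn_invFunOn hy
  have hki : ∀ w ∈ Metric.ball (f x) ε, ∀ w' ∈ Metric.ball (f x) ε,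
      dist (k w) (k w') = dist w w' := fun w hw w' hw' => by
    rw [← hfi _ (hkm w hw) _ (hkm w' hw'), hfk w hw, hfk w' hw']
  have hfda : ∀ y ∈ Metric.ball x ε, MDifferentiableAt 𝓘(ℂ) 𝓘(ℂ) f y := fun y hy =>
    hfd.mdifferentiableAt (Metric.isOpen_ball.mem_nhds hy)
  have hkc : ∀ w ∈ Metric.ball (f x) ε, ContinuousAt k w := by
    intro w hw
    have : LipschitzOnWith 1 k (Metric.ball (f x) ε) :=
      LipschitzOnWith.of_dist_le_mul fun a ha b hb => by simp [hki a ha b hb]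
    exact this.continuousOn.continuousAt (Metric.isOpen_ball.mem_nhds hw)
  have hkd : ∀ w ∈ Metric.ball (f x) ε, MDifferentiableAt 𝓘(ℂ) 𝓘(ℂ) k w := by
    intro w hw
    set y := k w with hy
    have hyb : y ∈ Metric.ball x ε := hkm w hw
    set e := chartAt ℂ y
    have hys : y ∈ e.source := mem_chart_source ℂ y
    have hsymm : Tendsto e.symm (𝓝 (e y)) (𝓝 y) := e.tendsto_symm hys
    have hes : e.symm (e y) = y := e.left_inv hys
    have hfu : ((f (e.symm (e y)) : ℍ) : ℂ) = w := by rw [hes, hfk w hw]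
    have hnear : ∀ᶠ v in 𝓝 (e y), v ∈ e.target ∧ e.symm v ∈ Metric.ball x ε :=
      (show ∀ᶠ v in 𝓝 (e y), v ∈ e.target from e.open_target.mem_nhds (e.map_source hys)).and
        (hsymm.eventually (Metric.isOpen_ball.mem_nhds hyb))
    have hnear' : ∀ᶠ v in 𝓝 (w : ℂ), ∃ a : ℍ, (a : ℂ) = v ∧ a ∈ Metric.ball (f x) ε ∧
        k a ∈ e.source := by
      rw [← UpperHalfPlane.isOpenEmbedding_coe.map_nhds_eq, eventually_map]
      filter_upwards [Metric.isOpen_ball.mem_nhds hw,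
        (hkc w hw).eventually (e.open_source.mem_nhds hys)] with a h1 h2 using ⟨a, rfl, h1, h2⟩
    have key : DifferentiableAt ℂ (fun v : ℂ => e (k (UpperHalfPlane.ofComplex v))) (w : ℂ) := by
      have := Complex.differentiableAt_of_local_inverse (u := e y)
        (f := fun v => (f (e.symm v) : ℂ))
        (k := fun v : ℂ => e (k (UpperHalfPlane.ofComplex v))) ?_ ?_ ?_ ?_
      · rwa [hfu] at this
      · filter_upwards [hnear] with v hv
        rw [← mdifferentiableAt_iff_differentiableAt]
        exact (UpperHalfPlane.mdifferentiable_coe _).comp v ((hfda _ hv.2).comp v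
          (mdifferentiableAt_atlas_symm (chart_mem_atlas ℂ y) hv.1))
      · simp only [hfu]
        filter_upwards [hnear'] with v hv
        obtain ⟨a, rfl, ha, hka⟩ := hv
        have h1 : ContinuousAt (fun v : ℂ => UpperHalfPlane.ofComplex v) (a : ℂ) :=
          (UpperHalfPlane.mdifferentiableAt_ofComplex a.im_pos).continuousAt
        refine ContinuousAt.comp (g := fun b : ℍ => e (k b)) ?_ h1
        rw [UpperHalfPlane.ofComplex_apply]
        exact ContinuousAt.comp (g := e) (e.continuousAt hka) (hkc a ha)
      · simp only [hfu]
        filter_upwards [hnear'] with v hv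
        obtain ⟨a, rfl, ha, hka⟩ := hv
        rw [UpperHalfPlane.ofComplex_apply, e.left_inv hka, hfk a ha]
      · filter_upwards [hnear] with v hv
        rw [UpperHalfPlane.ofComplex_apply, hkf _ hv.2, e.right_inv hv.1]
    have h2 : MDifferentiableAt 𝓘(ℂ) 𝓘(ℂ)
        (fun a : ℍ => e.symm (e (k (UpperHalfPlane.ofComplex (a : ℂ))))) w := by
      refine MDifferentiableAt.comp (I' := 𝓘(ℂ)) w (g := e.symm)
        (f := fun a : ℍ => e (k (UpperHalfPlane.ofComplex (a : ℂ)))) ?_ ?_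
      · refine mdifferentiableAt_atlas_symm (chart_mem_atlas ℂ y) ?_
        rw [UpperHalfPlane.ofComplex_apply]
        exact e.map_source hys
      · exact MDifferentiableAt.comp (I' := 𝓘(ℂ)) w
          (g := fun v : ℂ => e (k (UpperHalfPlane.ofComplex v)))
          key.mdifferentiableAt (UpperHalfPlane.mdifferentiable_coe w)
    refine h2.congr_of_eventuallyEq ?_
    filter_upwards [(hkc w hw).eventually (e.open_source.mem_nhds hys)] with a ha
    rw [UpperHalfPlane.ofComplex_apply, e.left_inv ha]
  have hfH : ∀ y ∈ Metric.ball x ε, HolIsomAt f y := fun y hy =>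
    ⟨⟨_, Metric.isOpen_ball.mem_nhds hy, hfi⟩, by
      filter_upwards [Metric.isOpen_ball.mem_nhds hy] with w hw using hfda w hw⟩
  refine ⟨ε, hε, f x, k, fun w hw => ⟨⟨_, Metric.isOpen_ball.mem_nhds hw, hki⟩, ?_⟩, hki,
    hkf x hx, fun F z hF hFz => ?_⟩
  · filter_upwards [Metric.isOpen_ball.mem_nhds hw] with w hw using hkd w hw
  · obtain ⟨g, hg⟩ := UpperHalfPlane.exists_smul_of_holIsomAt ((hfH _ hFz).comp hF)
    have hgz : f (F z) = g • z := hg.self_of_nhds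
    refine ⟨g, hgz ▸ hfm _ hFz, ?_⟩
    filter_upwards [hg, hF.continuousAt.eventually (Metric.isOpen_ball.mem_nhds hFz)] with u h1 h2
    rw [← h1, hkf _ h2]

/-- By continuity F p = G p, so both germs are k ∘ g₁ and k ∘ g₂ for one k. Where they agree on an
open set, injectivity of k gives g₁ = g₂ as maps. This is the closedness step of the identity
theorem. -/
theorem eventuallyEq_of_frequently (hS : IsHyperbolicMetric S) {F G : ℍ → S} {p : ℍ}
    (hF : HolIsomAt F p) (hG : HolIsomAt G p) (h : ∃ᶠ z in 𝓝 p, F =ᶠ[𝓝 z] G) :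
    F =ᶠ[𝓝 p] G := by
  have hp : F p = G p := by
    by_contra hne
    have h1 : ∀ᶠ z in 𝓝 p, F z ≠ G z :=
      (hF.continuousAt.ne_iff_eventually_ne hG.continuousAt).mp hne
    obtain ⟨z, hz, hz'⟩ := (h.and_eventually h1).exists
    exact hz' hz.self_of_nhds
  obtain ⟨ε, hε, q, k, -, hki, -, hk⟩ := hS.exists_parametrization (F p)
  obtain ⟨g₁, h₁, e₁⟩ := hk F p hF (Metric.mem_ball_self hε)
  obtain ⟨g₂, h₂, e₂⟩ := hk G p hG (hp ▸ Metric.mem_ball_self hε)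
  have hb₁ : ∀ᶠ z in 𝓝 p, g₁ • z ∈ Metric.ball q ε :=
    (UpperHalfPlane.holIsomAt_smul g₁ p).continuousAt.eventually (Metric.isOpen_ball.mem_nhds h₁)
  have hb₂ : ∀ᶠ z in 𝓝 p, g₂ • z ∈ Metric.ball q ε :=
    (UpperHalfPlane.holIsomAt_smul g₂ p).continuousAt.eventually (Metric.isOpen_ball.mem_nhds h₂)
  obtain ⟨z, hz, hz'⟩ := (h.and_eventually
    (((e₁.and e₂).and (hb₁.and hb₂)).eventually_nhds)).exists
  have heq : ∀ w : ℍ, g₁ • w = g₂ • w := by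
    refine UpperHalfPlane.smul_eq_smul_of_eventually (p := z) ?_
    filter_upwards [hz, hz'] with w hw hw'
    rw [← dist_eq_zero, ← hki _ hw'.2.1 _ hw'.2.2, ← hw'.1.1, ← hw'.1.2, hw, dist_self]
  filter_upwards [e₁, e₂] with w hw₁ hw₂
  rw [hw₁, hw₂, heq]

theorem eqOn_of_isPreconnected (hS : IsHyperbolicMetric S) {F G : ℍ → S} {U : Set ℍ}
    (hU : IsPreconnected U) (hF : ∀ z ∈ U, HolIsomAt F z) (hG : ∀ z ∈ U, HolIsomAt G z)
    {p : ℍ} (hp : p ∈ U) (h : F =ᶠ[𝓝 p] G) : EqOn F G U := by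
  have hsub : U ⊆ {z | F =ᶠ[𝓝 z] G} := by
    refine hU.subset_of_closure_inter_subset ?_ ⟨p, hp, h⟩ ?_
    · exact isOpen_iff_mem_nhds.mpr fun z hz => (eventually_eventually_nhds.mpr hz)
    · rintro z ⟨hz, hzU⟩
      exact hS.eventuallyEq_of_frequently (hF z hzU) (hG z hzU) (mem_closure_iff_frequently.mp hz)
  exact fun z hz => (hsub hz).self_of_nhds

/-- Two developing maps which take a common value differ by an isometry of `ℍ`. -/
theorem exists_smul_of_apply_eq (hS : IsHyperbolicMetric S) {F G : ℍ → S}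
    (hF : ∀ z, HolIsomAt F z) (hG : ∀ z, HolIsomAt G z) {z w : ℍ} (h : F z = G w) :
    ∃ g : SL(2, ℝ), g • z = w ∧ ∀ u, F u = G (g • u) := by
  obtain ⟨ε, hε, q, k, -, hki, -, hk⟩ := hS.exists_parametrization (F z)
  obtain ⟨g₁, h₁, e₁⟩ := hk F z (hF z) (Metric.mem_ball_self hε)
  obtain ⟨g₂, h₂, e₂⟩ := hk G w (hG w) (h ▸ Metric.mem_ball_self hε)
  have hg : g₁ • z = g₂ • w := by
    have hz : F z = k (g₁ • z) := e₁.self_of_nhds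
    have hw : G w = k (g₂ • w) := e₂.self_of_nhds
    rw [← dist_eq_zero, ← hki _ h₁ _ h₂, ← hz, ← hw, h, dist_self]
  have hgz : (g₂⁻¹ * g₁) • z = w := by rw [mul_smul, hg, inv_smul_smul]
  refine ⟨g₂⁻¹ * g₁, hgz, fun u => ?_⟩
  refine hS.eqOn_of_isPreconnected (G := fun u => G ((g₂⁻¹ * g₁) • u)) (p := z) isPreconnected_univ
    (fun u _ => hF u)
    (fun u _ => (hG _).comp (UpperHalfPlane.holIsomAt_smul _ u)) (mem_univ z) ?_ (mem_univ u)
  have hc : Tendsto (fun u : ℍ => (g₂⁻¹ * g₁) • u) (𝓝 z) (𝓝 w) := by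
    have := (UpperHalfPlane.holIsomAt_smul (g₂⁻¹ * g₁) z).continuousAt
    rwa [ContinuousAt, hgz] at this
  filter_upwards [e₁, hc.eventually e₂] with u hu hu'
  rw [hu, hu', mul_smul, smul_inv_smul]

end IsHyperbolicMetric

/-! ### Continuation of a developing map down vertical lines. -/

theorem dist_le_of_locally_isometric {M : Type*} [MetricSpace M] {γ : ℝ → M} {a b : ℝ}
    (hab : a ≤ b) (h : ∀ s ∈ Icc a b, ∃ V ∈ 𝓝 s, ∀ u ∈ V, ∀ v ∈ V, dist (γ u) (γ v) = dist u v) :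
    dist (γ a) (γ b) ≤ b - a := by
  have hc : ContinuousOn γ (Icc a b) := by
    intro s hs
    obtain ⟨V, hV, hi⟩ := h s hs
    have : LipschitzOnWith 1 γ V :=
      LipschitzOnWith.of_dist_le_mul fun u hu v hv => by simp [hi u hu v hv]
    exact (this.continuousOn.continuousAt hV).continuousWithinAt
  have hcl : IsClosed ({s | dist (γ a) (γ s) - (s - a) ≤ 0} ∩ Icc a b) := by
    rw [inter_comm]
    exact (ContinuousOn.sub (fun s hs => tendsto_const_nhds.dist (hc s hs)) (continuousOn_id.sub continuousOn_const)
      ).preimage_isClosed_of_isClosed isClosed_Icc isClosed_Iic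
  -- Continuous induction: the bound holds on a closed set, and the local isometry with the triangle
  -- inequality pushes it to the right.
  have := hcl.Icc_subset_of_forall_exists_gt (by simp) ?_ ⟨hab, le_rfl⟩
  · simpa using this
  · rintro s ⟨hs, hs1, hs2⟩ y hy
    obtain ⟨V, hV, hi⟩ := h s ⟨hs1, hs2.le⟩
    have h1 : V ∩ Ioc s y ∈ 𝓝[>] s :=
      inter_mem (mem_nhdsWithin_of_mem_nhds hV) (Ioc_mem_nhdsGT hy)
    obtain ⟨v, hvV, hv⟩ := Filter.nonempty_of_mem h1
    refine ⟨v, ?_, hv⟩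
    have h2 := hi s (mem_of_mem_nhds hV) v hvV
    rw [Real.dist_eq, abs_sub_comm, abs_of_pos (sub_pos.mpr hv.1)] at h2
    have h3 := dist_triangle (γ a) (γ s) (γ v)
    have hs' : dist (γ a) (γ s) - (s - a) ≤ 0 := hs
    change dist (γ a) (γ v) - (v - a) ≤ 0
    linarith

namespace UpperHalfPlane

theorem isPreconnected_setOf_re_mem_im_mem {s t : Set ℝ} (hs : Convex ℝ s) (ht : Convex ℝ t) :
    IsPreconnected {z : ℍ | z.re ∈ s ∧ z.im ∈ t} := by
  rw [← isOpenEmbedding_coe.isInducing.isPreconnected_image]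
  have : ((↑) : ℍ → ℂ) '' {z : ℍ | z.re ∈ s ∧ z.im ∈ t} = s ×ℂ (t ∩ Ioi 0) := by
    ext w
    constructor
    · rintro ⟨z, hz, rfl⟩
      exact ⟨hz.1, hz.2, z.im_pos⟩
    · rintro ⟨h1, h2, h3⟩
      exact ⟨⟨w, h3⟩, ⟨h1, h2⟩, rfl⟩
  rw [this]
  exact ((hs.linear_preimage Complex.reLm).inter
    ((ht.inter (convex_Ioi 0)).linear_preimage Complex.imLm)).isPreconnected

theorem dist_le_div_of_le_im {z w : ℍ} {m : ℝ} (hm : 0 < m) (hz : m ≤ z.im) (hw : m ≤ w.im) :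
    dist z w ≤ (|z.re - w.re| + |z.im - w.im|) / m := by
  refine (dist_le_dist_coe_div_sqrt z w).trans ?_
  have h1 : m ≤ √(z.im * w.im) := Real.le_sqrt_of_sq_le (by nlinarith)
  have h2 : dist (z : ℂ) w ≤ |z.re - w.re| + |z.im - w.im| := by
    rw [Complex.dist_eq]
    simpa using Complex.norm_le_abs_re_add_abs_im ((z : ℂ) - w)
  gcongr

end UpperHalfPlane

/-- The vertical line is a unit speed geodesic in s, so its image is 1-Lipschitz, hence Cauchy as s
↓ s₀; completeness supplies the limit. -/
theorem HolIsomAt.exists_tendsto_vertical {S : Type*} [MetricSpace S] [ChartedSpace ℂ S]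
    [CompleteSpace S] {F : ℍ → S} {x s₀ : ℝ}
    (hF : ∀ z : ℍ, z.re = x → Real.exp s₀ < z.im → HolIsomAt F z) :
    ∃ y, Tendsto (fun s : ℝ => F ⟨⟨x, Real.exp s⟩, Real.exp_pos s⟩) (𝓝[>] s₀) (𝓝 y) := by
  set γ : ℝ → S := fun s => F ⟨⟨x, Real.exp s⟩, Real.exp_pos s⟩ with hγ
  have hloc : ∀ s, s₀ < s → ∃ V ∈ 𝓝 s, ∀ u ∈ V, ∀ v ∈ V, dist (γ u) (γ v) = dist u v := by
    intro s hs
    have hi := UpperHalfPlane.isometry_vertical_line x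
    obtain ⟨V, hV, hV'⟩ := (hF ⟨⟨x, Real.exp s⟩, Real.exp_pos s⟩ rfl (Real.exp_lt_exp.mpr hs)).isom
    refine ⟨_, hi.continuous.continuousAt.preimage_mem_nhds hV, fun u hu v hv => ?_⟩
    rw [hV' _ hu _ hv, ← hi.dist_eq u v]
  have hle : ∀ u v, s₀ < u → u ≤ v → dist (γ u) (γ v) ≤ v - u := fun u v hu huv =>
    dist_le_of_locally_isometric huv fun s hs => hloc s (hu.trans_le hs.1)
  have hcauchy : Cauchy (map γ (𝓝[>] s₀)) := by
    rw [Metric.cauchy_iff]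
    refine ⟨inferInstance, fun ε hε => ⟨γ '' Ioo s₀ (s₀ + ε),
      image_mem_map (Ioo_mem_nhdsGT (by linarith)), ?_⟩⟩
    rintro _ ⟨u, hu, rfl⟩ _ ⟨v, hv, rfl⟩
    rcases le_total u v with h | h
    · linarith [hle u v hu.1 h, hu.1, hv.2]
    · rw [dist_comm]
      linarith [hle v u hv.1 h, hv.1, hu.2]
  exact CompleteSpace.complete hcauchy

/-- The map `G` extends the developing map `F` to a vertical strip: it is locally isometric on the
strip, and it agrees with `F` above the height `Y`. -/
def IsStripExtension {S : Type*} [MetricSpace S] [ChartedSpace ℂ S] (F : ℍ → S) (Y x δ t : ℝ)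
    (G : ℍ → S) : Prop :=
  ∀ z : ℍ, |z.re - x| < δ → t < z.im → HolIsomAt G z ∧ (Y < z.im → G z = F z)

theorem isOpen_strip (x δ t : ℝ) : IsOpen {z : ℍ | |z.re - x| < δ ∧ t < z.im} :=
  (isOpen_lt (UpperHalfPlane.continuous_re.sub continuous_const).abs continuous_const).inter
    (isOpen_lt continuous_const UpperHalfPlane.continuous_im)

namespace IsHyperbolicMetric

variable {S : Type*} [MetricSpace S] [ChartedSpace ℂ S] [IsManifold 𝓘(ℂ) ω S]
  {F₀ : ℍ → S} {Y : ℝ}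

/-- Two strips meet in a convex region reaching above height Y, where both extensions are F₀. Thus
no monodromy arises, and all strip extensions glue to one map. -/
theorem eq_of_isStripExtension (hS : IsHyperbolicMetric S) {x₁ δ₁ t₁ x₂ δ₂ t₂ : ℝ} {G₁ G₂ : ℍ → S}
    (h₁ : IsStripExtension F₀ Y x₁ δ₁ t₁ G₁) (h₂ : IsStripExtension F₀ Y x₂ δ₂ t₂ G₂) {z : ℍ}
    (hz₁ : |z.re - x₁| < δ₁) (ht₁ : t₁ < z.im) (hz₂ : |z.re - x₂| < δ₂) (ht₂ : t₂ < z.im) :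
    G₁ z = G₂ z := by
  have hpos : 0 < max Y z.im + 1 := by linarith [le_max_right Y z.im, z.im_pos]
  set p : ℍ := ⟨⟨z.re, max Y z.im + 1⟩, hpos⟩
  have hpre : p.re = z.re := rfl
  have hpim : p.im = max Y z.im + 1 := rfl
  have hp1 : Y < p.im := by linarith [le_max_left Y z.im]
  have hp2 : z.im < p.im := by linarith [le_max_right Y z.im]
  have hpc := UpperHalfPlane.isPreconnected_setOf_re_mem_im_mem
    ((convex_ball x₁ δ₁).inter (convex_ball x₂ δ₂)) ((convex_Ioi t₁).inter (convex_Ioi t₂))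
  refine hS.eqOn_of_isPreconnected hpc (fun w hw => (h₁ w hw.1.1 hw.2.1).1)
    (fun w hw => (h₂ w hw.1.2 hw.2.2).1)
    (p := p) ⟨⟨hz₁, hz₂⟩, ht₁.trans hp2, ht₂.trans hp2⟩ ?_ ⟨⟨hz₁, hz₂⟩, ht₁, ht₂⟩
  filter_upwards [(isOpen_strip x₁ δ₁ t₁).mem_nhds (x := p) ⟨hz₁, ht₁.trans hp2⟩,
    (isOpen_strip x₂ δ₂ t₂).mem_nhds (x := p) ⟨hz₂, ht₂.trans hp2⟩,
    UpperHalfPlane.continuous_im.continuousAt.eventually (lt_mem_nhds hp1)] with w hw₁ hw₂ hw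
  rw [(h₁ w hw₁.1 hw₁.2).2 hw, (h₂ w hw₂.1 hw₂.2).2 hw]

theorem exists_forall_isStripExtension (hS : IsHyperbolicMetric S) (F₀ : ℍ → S) (Y : ℝ) :
    ∃ F : ℍ → S, ∀ x δ t G, IsStripExtension F₀ Y x δ t G → IsStripExtension F₀ Y x δ t F := by
  classical
  have hex : ∀ z : ℍ, ∃ s : S, ∀ x δ t G, IsStripExtension F₀ Y x δ t G →
      |z.re - x| < δ → t < z.im → s = G z := by
    intro z
    by_cases h : ∃ x δ t G, IsStripExtension F₀ Y x δ t G ∧ |z.re - x| < δ ∧ t < z.im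
    · obtain ⟨x, δ, t, G, hG, h1, h2⟩ := h
      exact ⟨G z, fun x' δ' t' G' hG' h1' h2' => hS.eq_of_isStripExtension hG hG' h1 h2 h1' h2'⟩
    · exact ⟨F₀ z, fun x δ t G hG h1 h2 => (h ⟨x, δ, t, G, hG, h1, h2⟩).elim⟩
  choose F hF using hex
  refine ⟨F, fun x δ t G hG z h1 h2 => ⟨(hG z h1 h2).1.congr ?_, fun hY => ?_⟩⟩
  · filter_upwards [(isOpen_strip x δ t).mem_nhds (x := z) ⟨h1, h2⟩] with w hw
    exact (hF w x δ t G hG hw.1 hw.2).symm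
  · rw [hF z x δ t G hG h1 h2, (hG z h1 h2).2 hY]

/-- Along the line Re = x, F has a limit at height t₀. The local model there describes F just above
t₀ and continues it below. -/
theorem exists_isStripExtension_below (hS : IsHyperbolicMetric S) [CompleteSpace S] {F : ℍ → S}
    {x t₀ : ℝ} (ht₀ : 0 < t₀) (htY : t₀ < Y)
    (hF : ∀ t, t₀ < t → ∃ δ > 0, IsStripExtension F₀ Y x δ t F) :
    ∃ t < t₀, 0 < t ∧ ∃ δ > 0, ∃ G, IsStripExtension F₀ Y x δ t G := by
  have hFz : ∀ z : ℍ, z.re = x → t₀ < z.im → HolIsomAt F z := by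
    intro z hz ht
    obtain ⟨t, h1, h2⟩ := exists_between ht
    obtain ⟨δ, hδ, h⟩ := hF t h1
    exact (h z (by simpa [hz] using hδ) h2).1
  obtain ⟨y, hy⟩ := HolIsomAt.exists_tendsto_vertical (F := F) (x := x) (s₀ := Real.log t₀)
    (by rwa [Real.exp_log ht₀])
  obtain ⟨ε, hε, p, k, hkH, hki, hkp, hk⟩ := hS.exists_parametrization y
  -- These bounds keep the box above height t₀ / 2, make its points lie within 3η / (t₀ / 2) ≤ ε / 4
  -- of `z'`, and keep it below Y, where agreement with F₀ is not demanded.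
  obtain ⟨η, hη, hη1, hη2, hη3⟩ : ∃ η > 0, η ≤ t₀ / 2 ∧ η ≤ t₀ * ε / 24 ∧ η ≤ Y - t₀ :=
    ⟨min (t₀ / 2) (min (t₀ * ε / 24) (Y - t₀)),
      lt_min (by positivity) (lt_min (by positivity) (by linarith)), min_le_left _ _,
      (min_le_right _ _).trans (min_le_left _ _), (min_le_right _ _).trans (min_le_right _ _)⟩
  have hexp : ∀ᶠ s in 𝓝[>] Real.log t₀, Real.exp s < t₀ + η := by
    refine (Real.continuous_exp.continuousAt.eventually (gt_mem_nhds ?_)).filter_mono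
      nhdsWithin_le_nhds
    rw [Real.exp_log ht₀]; linarith
  obtain ⟨σ, hσy, hσ1, hσ2⟩ := ((hy.eventually (Metric.ball_mem_nhds y (half_pos hε))).and
    (hexp.and self_mem_nhdsWithin)).exists
  set z' : ℍ := ⟨⟨x, Real.exp σ⟩, Real.exp_pos σ⟩
  have hre : z'.re = x := rfl
  have ht1 : t₀ < z'.im := by
    have := Real.exp_lt_exp.mpr hσ2
    rwa [Real.exp_log ht₀] at this
  have ht2 : z'.im < t₀ + η := hσ1
  obtain ⟨g, hgb, hg⟩ := hk F z' (hFz z' hre ht1)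
    (Metric.ball_subset_ball (half_le_self hε.le) hσy)
  have hgp : dist (g • z') p < ε / 2 := by
    rw [← hki _ hgb _ (Metric.mem_ball_self hε), hkp]
    have : F z' = k (g • z') := hg.self_of_nhds
    rw [← this]
    exact hσy
  have hG₁ : ∀ u : ℍ, |u.re - x| < η → t₀ - η < u.im → u.im < t₀ + η →
      HolIsomAt (fun u => k (g • u)) u := by
    intro u h1 h2 h3
    refine (hkH _ ?_).comp (UpperHalfPlane.holIsomAt_smul g u)
    have hd : dist u z' < ε / 2 := by
      have h4 := UpperHalfPlane.dist_le_div_of_le_im (z := u) (w := z') (m := t₀ / 2)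
        (by positivity) (by linarith) (by linarith)
      refine h4.trans_lt ?_
      rw [div_lt_iff₀ (by positivity), hre]
      have h5 : |u.im - z'.im| < 2 * η := abs_lt.mpr ⟨by linarith, by linarith⟩
      nlinarith
    rw [Metric.mem_ball]
    calc dist (g • u) p ≤ dist (g • u) (g • z') + dist (g • z') p := dist_triangle _ _ _
      _ < ε := by rw [dist_smul]; linarith
  -- Only the width at this one height is used, so it does not matter if the given widths shrink to
  -- 0 as t ↓ t₀.
  obtain ⟨t', ht', ht''⟩ := exists_between ht1
  obtain ⟨δ, hδ, hFδ⟩ := hF t' ht'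
  set δ' := min δ η with hδ'
  have hδ'0 : 0 < δ' := lt_min hδ hη
  have hagree : ∀ z : ℍ, |z.re - x| < δ' → t' < z.im → z.im < t₀ + η → F z = k (g • z) := by
    intro z h1 h2 h3
    have hpc := UpperHalfPlane.isPreconnected_setOf_re_mem_im_mem
      (convex_ball x δ') (convex_Ioo t' (t₀ + η))
    exact hS.eqOn_of_isPreconnected hpc
      (fun w hw => (hFδ w (lt_of_lt_of_le hw.1 (min_le_left _ _)) hw.2.1).1)
      (fun w hw => hG₁ w (lt_of_lt_of_le hw.1 (min_le_right _ _)) (by linarith [hw.2.1]) hw.2.2)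
      (p := z') ⟨by simpa [hre] using hδ'0, ht'', ht2⟩ hg ⟨h1, h2, h3⟩
  classical
  refine ⟨t₀ - η, by linarith, by linarith, δ', hδ'0,
    fun z => if z'.im < z.im then F z else k (g • z), fun z h1 h2 => ?_⟩
  by_cases hz : z'.im < z.im
  · have h3 := hFδ z (h1.trans_le (min_le_left _ _)) (ht''.trans hz)
    refine ⟨h3.1.congr ?_, fun hY => (if_pos hz).trans (h3.2 hY)⟩
    filter_upwards [UpperHalfPlane.continuous_im.continuousAt.eventually (lt_mem_nhds hz)] with w hw
    rw [if_pos hw]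
  · have hz2 : z.im < t₀ + η := (not_lt.mp hz).trans_lt ht2
    refine ⟨(hG₁ z (h1.trans_le (min_le_right _ _)) h2 hz2).congr ?_, fun hY => by linarith⟩
    filter_upwards [UpperHalfPlane.continuous_im.continuousAt.eventually (gt_mem_nhds hz2),
      (isOpen_strip x δ' (t₀ - η)).mem_nhds (x := z) ⟨h1, h2⟩] with w hw hw'
    split_ifs with h
    · exact (hagree w hw'.1 (ht''.trans h) hw).symm
    · rfl

/-- A developing map defined near the cusp at infinity extends to the hyperbolic plane. -/
theorem exists_holIsomAt_extension (hS : IsHyperbolicMetric S) [CompleteSpace S] {Z : ℝ}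
    (hZ : 0 < Z) (hZY : Z < Y) (hF₀ : ∀ z : ℍ, Z < z.im → HolIsomAt F₀ z) :
    ∃ F : ℍ → S, (∀ z, HolIsomAt F z) ∧ ∀ z : ℍ, Y < z.im → F z = F₀ z := by
  obtain ⟨F, hF⟩ := hS.exists_forall_isStripExtension F₀ Y
  have key : ∀ x t, 0 < t → ∃ δ > 0, IsStripExtension F₀ Y x δ t F := by
    intro x t ht
    by_contra hcon
    -- If some t > 0 were not reached, the infimum of the reachable heights would be positive and
    -- below Y, and could then be undercut.
    set A : Set ℝ := {t | 0 < t ∧ ∃ δ > 0, IsStripExtension F₀ Y x δ t F} with hA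
    have hup : ∀ a ∈ A, ∀ b, a ≤ b → b ∈ A := by
      rintro a ⟨ha, δ, hδ, h⟩ b hab
      exact ⟨ha.trans_le hab, δ, hδ, fun z h1 h2 => h z h1 (hab.trans_lt h2)⟩
    have hZA : Z ∈ A := ⟨hZ, 1, one_pos, hF _ _ _ F₀ fun z _ hz => ⟨hF₀ z hz, fun _ => rfl⟩⟩
    have hlb : t ∈ lowerBounds A := fun a ha => by
      by_contra hlt
      exact hcon (hup a ha t (not_le.mp hlt).le).2
    have hbdd : BddBelow A := ⟨t, hlb⟩
    obtain ⟨s, hs, hs0, δ, hδ, G, hG⟩ := hS.exists_isStripExtension_below (F₀ := F₀) (Y := Y)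
      (F := F) (x := x) (t₀ := sInf A) (ht.trans_le (le_csInf ⟨Z, hZA⟩ hlb))
      ((csInf_le hbdd hZA).trans_lt hZY) (fun r hr => by
        obtain ⟨a, ha, har⟩ := exists_lt_of_csInf_lt ⟨Z, hZA⟩ hr
        exact (hup a ha r har.le).2)
    exact absurd (csInf_le hbdd (show s ∈ A from ⟨hs0, δ, hδ, hF _ _ _ _ hG⟩)) (not_le.mpr hs)
  have hz : ∀ z : ℍ, HolIsomAt F z ∧ (Y < z.im → F z = F₀ z) := fun z => by
    obtain ⟨δ, hδ, h⟩ := key z.re (z.im / 2) (half_pos z.im_pos)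
    exact h z (by simpa using hδ) (half_lt_self z.im_pos)
  exact ⟨F, fun z => (hz z).1, fun z => (hz z).2⟩

end IsHyperbolicMetric

/-! ### Shimizu's lemma. -/

namespace UpperHalfPlane

/-- The parabolic translation `z ↦ z + t` of the hyperbolic plane. -/
noncomputable def translation (t : ℝ) : SL(2, ℝ) :=
  ⟨!![1, t; 0, 1], by rw [Matrix.det_fin_two_of]; ring⟩

theorem coe_translation_smul (t : ℝ) (z : ℍ) : ((translation t • z : ℍ) : ℂ) = z + t := by
  rw [coe_sl_smul]; simp [translation]

theorem sl_det_eq (g : SL(2, ℝ)) : g 0 0 * g 1 1 - g 0 1 * g 1 0 = 1 := by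
  have := g.det_coe
  rwa [Matrix.det_fin_two] at this

theorem sl_im_smul (g : SL(2, ℝ)) (z : ℍ) :
    (g • z).im = z.im / Complex.normSq ((g 1 0 : ℂ) * z + g 1 1) := by
  have := im_smul_eq_div_normSq (Matrix.SpecialLinearGroup.mapGL ℝ g) z
  simpa [denom] using! this

theorem sl_im_smul_mul (g : SL(2, ℝ)) (z : ℍ) :
    (g • z).im * ((g 1 0 * z.re + g 1 1) ^ 2 + (g 1 0 * z.im) ^ 2) = z.im := by
  have h : Complex.normSq ((g 1 0 : ℂ) * z + g 1 1) =
      (g 1 0 * z.re + g 1 1) ^ 2 + (g 1 0 * z.im) ^ 2 := by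
    rw [Complex.normSq_apply]; simp; ring
  rw [← h, sl_im_smul, div_mul_cancel₀]
  exact (Complex.normSq_pos.mpr (sl_denom_ne_zero g z)).ne'

theorem coe_smul_of_lower_left_eq_zero {g : SL(2, ℝ)} (hg : g 1 0 = 0) (z : ℍ) :
    ((g • z : ℍ) : ℂ) = (g 0 0 : ℂ) ^ 2 * z + g 0 0 * g 0 1 := by
  have hdet : (g 0 0 : ℂ) * g 1 1 = 1 := by
    have := sl_det_eq g
    rw [hg, mul_zero, sub_zero] at this
    exact_mod_cast this
  have hd : (g 1 1 : ℂ) ≠ 0 := right_ne_zero_of_mul_eq_one hdet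
  rw [coe_sl_smul, hg, Complex.ofReal_zero, zero_mul, zero_add, div_eq_iff hd]
  linear_combination (-(g 0 0 : ℂ) * z - g 0 1) * hdet

/-- The iteration `g ↦ g T g⁻¹` of Shimizu's lemma, where `T` is the translation by `1`. -/
noncomputable def shimizuSeq (g : SL(2, ℝ)) : ℕ → SL(2, ℝ)
  | 0 => g
  | n + 1 => shimizuSeq g n * translation 1 * (shimizuSeq g n)⁻¹

theorem conj_translation (g : SL(2, ℝ)) :
    ((g * translation 1 * g⁻¹ : SL(2, ℝ)) : Matrix (Fin 2) (Fin 2) ℝ) =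
      !![1 - g 0 0 * g 1 0, g 0 0 ^ 2; -g 1 0 ^ 2, 1 + g 0 0 * g 1 0] := by
  have hdet := sl_det_eq g
  rw [Matrix.SpecialLinearGroup.coe_mul, Matrix.SpecialLinearGroup.coe_mul,
    Matrix.SpecialLinearGroup.coe_inv, Matrix.adjugate_fin_two]
  ext i j
  fin_cases i <;> fin_cases j <;>
    simp [translation, Matrix.mul_apply, Fin.sum_univ_two] <;> grind

variable {g : SL(2, ℝ)}

theorem coe_shimizuSeq_succ (g : SL(2, ℝ)) (n : ℕ) :
    (shimizuSeq g (n + 1) : Matrix (Fin 2) (Fin 2) ℝ) =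
      !![1 - shimizuSeq g n 0 0 * shimizuSeq g n 1 0, shimizuSeq g n 0 0 ^ 2;
        -shimizuSeq g n 1 0 ^ 2, 1 + shimizuSeq g n 0 0 * shimizuSeq g n 1 0] :=
  conj_translation _

theorem shimizuSeq_lower_left_ne_zero (hg : g 1 0 ≠ 0) (n : ℕ) : shimizuSeq g n 1 0 ≠ 0 := by
  induction n with
  | zero => exact hg
  | succ n ih => simpa [coe_shimizuSeq_succ] using ih

theorem abs_shimizuSeq_lower_left_le (hg : |g 1 0| < 1) (n : ℕ) :
    |shimizuSeq g n 1 0| ≤ |g 1 0| ^ (n + 1) := by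
  induction n with
  | zero => simp [shimizuSeq]
  | succ n ih =>
    have h0 : shimizuSeq g (n + 1) 1 0 = -shimizuSeq g n 1 0 ^ 2 := by
      simp [coe_shimizuSeq_succ]
    have h1 : |g 1 0| ^ (n + 1) ≤ |g 1 0| := pow_le_of_le_one (abs_nonneg _) hg.le n.succ_ne_zero
    rw [h0, abs_neg, abs_pow, pow_two, pow_succ]
    exact mul_le_mul ih (ih.trans h1) (abs_nonneg _) (by positivity)

theorem exists_abs_shimizuSeq_upper_left_le (hg : |g 1 0| < 1) :
    ∃ K, ∀ n, |shimizuSeq g n 0 0| ≤ K := by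
  have hpos : 0 < 1 - |g 1 0| := by linarith
  -- Chosen so that 1 + K |c| ≤ K, which makes the bound stable under a ↦ 1 - a c.
  set K := |g 0 0| + 1 / (1 - |g 1 0|) with hK
  have hK1 : 1 ≤ K * (1 - |g 1 0|) := by
    rw [hK, add_mul, div_mul_cancel₀ _ hpos.ne']
    nlinarith [abs_nonneg (g 0 0)]
  refine ⟨K, fun n => ?_⟩
  induction n with
  | zero => simp only [shimizuSeq, hK]; linarith [one_div_pos.mpr hpos]
  | succ n ih =>
    have h0 : shimizuSeq g (n + 1) 0 0 = 1 - shimizuSeq g n 0 0 * shimizuSeq g n 1 0 := by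
      simp [coe_shimizuSeq_succ]
    have h1 : |shimizuSeq g n 1 0| ≤ |g 1 0| := (abs_shimizuSeq_lower_left_le hg n).trans
      (pow_le_of_le_one (abs_nonneg _) hg.le n.succ_ne_zero)
    have h2 : |shimizuSeq g n 0 0 * shimizuSeq g n 1 0| ≤ K * |g 1 0| := by
      rw [abs_mul]
      exact mul_le_mul ih h1 (abs_nonneg _) ((abs_nonneg _).trans ih)
    rw [h0]
    have h3 := abs_sub (1 : ℝ) (shimizuSeq g n 0 0 * shimizuSeq g n 1 0)
    rw [abs_one] at h3
    nlinarith

/-- The recursion sends c to -c² and a to 1 - a c. With |c| < 1, c tends to 0 while a stays bounded,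
so the matrices tend to the translation. -/
theorem tendsto_shimizuSeq_smul (hg : |g 1 0| < 1) (z : ℍ) :
    Tendsto (fun n => shimizuSeq g n • z) atTop (𝓝 (translation 1 • z)) := by
  obtain ⟨K, hK⟩ := exists_abs_shimizuSeq_upper_left_le hg
  have hc : Tendsto (fun n => shimizuSeq g n 1 0) atTop (𝓝 0) := by
    refine squeeze_zero_norm (fun n => abs_shimizuSeq_lower_left_le hg n) ?_
    exact (tendsto_pow_atTop_nhds_zero_of_lt_one (abs_nonneg _) hg).comp (tendsto_add_atTop_nat 1)
  have hac : Tendsto (fun n => shimizuSeq g n 0 0 * shimizuSeq g n 1 0) atTop (𝓝 0) := by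
    refine squeeze_zero_norm (a := fun n => K * |shimizuSeq g n 1 0|) (fun n => ?_) ?_
    · rw [norm_mul]
      exact mul_le_mul_of_nonneg_right (hK n) (abs_nonneg _)
    · simpa using hc.abs.const_mul K
  have h00 : Tendsto (fun n => shimizuSeq g n 0 0) atTop (𝓝 1) := by
    rw [← tendsto_add_atTop_iff_nat 1]
    simpa [coe_shimizuSeq_succ] using hac.const_sub 1
  have h01 : Tendsto (fun n => shimizuSeq g n 0 1) atTop (𝓝 1) := by
    rw [← tendsto_add_atTop_iff_nat 1]
    simpa [coe_shimizuSeq_succ] using h00.pow 2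
  have h11 : Tendsto (fun n => shimizuSeq g n 1 1) atTop (𝓝 1) := by
    rw [← tendsto_add_atTop_iff_nat 1]
    simpa [coe_shimizuSeq_succ] using hac.const_add 1
  rw [isEmbedding_coe.tendsto_nhds_iff]
  have hlift : ∀ {u : ℕ → ℝ} {l : ℝ}, Tendsto u atTop (𝓝 l) →
      Tendsto (fun n => (u n : ℂ)) atTop (𝓝 (l : ℂ)) := fun h =>
    (Complex.continuous_ofReal.tendsto _).comp h
  have key := (((hlift h00).mul_const (z : ℂ)).add (hlift h01)).div
    (((hlift hc).mul_const (z : ℂ)).add (hlift h11)) (by simp)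
  rw [coe_translation_smul]
  simpa [Function.comp_def, coe_sl_smul, Pi.div_def] using key

end UpperHalfPlane

open UpperHalfPlane

section Shimizu

variable {S : Type*} [MetricSpace S] [ChartedSpace ℂ S] {F : ℍ → S} {g : SL(2, ℝ)}

/-- **Shimizu's lemma** for the isometries of `ℍ` that preserve a developing map. -/
theorem one_le_abs_lower_left (hF : ∀ z, HolIsomAt F z) (hT : ∀ z, F (translation 1 • z) = F z)
    (hg : ∀ z, F (g • z) = F z) (hc : g 1 0 ≠ 0) : 1 ≤ |g 1 0| := by
  by_contra! hlt
  have hmem : ∀ n z, F (shimizuSeq g n • z) = F z := by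
    intro n
    induction n with
    | zero => exact hg
    | succ n ih =>
      intro z
      rw [shimizuSeq, mul_smul, mul_smul, ih, hT, ← ih, smul_inv_smul]
  -- Local injectivity of F acts as discreteness: points with the same image under F that converge
  -- to T z must eventually equal it.
  have hev : ∀ z : ℍ, ∀ᶠ n in atTop, shimizuSeq g n • z = translation 1 • z := by
    intro z
    obtain ⟨V, hV, hi⟩ := (hF (translation 1 • z)).isom
    filter_upwards [(tendsto_shimizuSeq_smul hlt z).eventually hV] with n hn
    rw [← dist_eq_zero, ← hi _ hn _ (mem_of_mem_nhds hV), hmem, hT, dist_self]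
  have him : ∀ z : ℍ, (translation 1 • z : ℍ).im = z.im := fun z => by
    have := congrArg Complex.im (coe_translation_smul 1 z)
    simpa using this
  -- Preserving the heights of i and 2i gives d² + c² = 1 = d² + 4c², so c = 0, although c never
  -- vanishes along the sequence.
  set J : ℍ := ⟨⟨0, 2⟩, by norm_num⟩
  obtain ⟨n, h1, h2⟩ := ((hev I).and (hev J)).exists
  have e1 := sl_im_smul_mul (shimizuSeq g n) I
  have e2 := sl_im_smul_mul (shimizuSeq g n) J
  rw [h1, him] at e1
  rw [h2, him] at e2
  have hJr : J.re = 0 := rfl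
  have hJi : J.im = 2 := rfl
  rw [hJr, hJi] at e2
  simp only [I_re, I_im] at e1
  exact shimizuSeq_lower_left_ne_zero hc n (pow_eq_zero_iff two_ne_zero |>.mp (by linarith))

/-- An isometry which carries a point of the horodisk `{z | 1 < z.im}` of one cusp to a point of
the horodisk of another one fixes the point at infinity. -/
theorem lower_left_eq_zero {G : ℍ → S} (hG : ∀ z, HolIsomAt G z)
    (hTF : ∀ z, F (translation 1 • z) = F z) (hTG : ∀ z, G (translation 1 • z) = G z)
    (hg : ∀ z, F z = G (g • z)) {z : ℍ} (hz : 1 < z.im) (hgz : 1 < (g • z).im) : g 1 0 = 0 := by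
  by_contra hc
  have hc' : (g * translation 1 * g⁻¹) 1 0 = -g 1 0 ^ 2 := by rw [conj_translation]; simp
  have h1 : 1 ≤ |(g * translation 1 * g⁻¹) 1 0| := by
    refine one_le_abs_lower_left hG hTG (fun w => ?_) (by rw [hc']; simpa using hc)
    rw [mul_smul, mul_smul, ← hg, hTF, hg, smul_inv_smul]
  rw [hc', abs_neg, abs_of_nonneg (sq_nonneg _)] at h1
  have h2 := sl_im_smul_mul g z
  have h3 : z.im * 1 < z.im * z.im := mul_lt_mul_of_pos_left hz z.im_pos
  have h4 : z.im * z.im ≤ (g 1 0 * z.re + g 1 1) ^ 2 + (g 1 0 * z.im) ^ 2 := by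
    nlinarith [sq_nonneg (g 1 0 * z.re + g 1 1), sq_nonneg z.im]
  nlinarith [z.im_pos]

end Shimizu

/-! ### Area of a punctured disk. -/

section Area

open MeasureTheory

theorem hasDerivAt_neg_inv_log {x : ℝ} (h0 : 0 < x) (h1 : x < 1) :
    HasDerivAt (fun x => -(Real.log x)⁻¹) (x * (-1 / (x * Real.log x)) ^ 2) x := by
  have hl : Real.log x ≠ 0 := (Real.log_neg h0 h1).ne
  have h : x * (-1 / (x * Real.log x)) ^ 2 = -(-x⁻¹ / Real.log x ^ 2) := by field_simp
  rw [h]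
  exact ((Real.hasDerivAt_log h0.ne').inv hl).neg

theorem ofReal_neg_inv_log_le_lintegral {r : ℝ} (hr : 0 < r) (hr1 : r < 1) :
    ENNReal.ofReal (-(Real.log r)⁻¹) ≤
      ∫⁻ x in Ioo 0 r, ENNReal.ofReal (x * (-1 / (x * Real.log x)) ^ 2) := by
  have hbound : ∀ᶠ a in 𝓝[>] (0 : ℝ), ENNReal.ofReal (-(Real.log r)⁻¹ - -(Real.log a)⁻¹) ≤
      ∫⁻ x in Ioo 0 r, ENNReal.ofReal (x * (-1 / (x * Real.log x)) ^ 2) := by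
    filter_upwards [Ioo_mem_nhdsGT hr] with a ha
    have hpos : ∀ x ∈ Icc a r, 0 < x ∧ x < 1 := fun x hx =>
      ⟨ha.1.trans_le hx.1, hx.2.trans_lt hr1⟩
    have hcont : ContinuousOn (fun x : ℝ => x * (-1 / (x * Real.log x)) ^ 2) (Icc a r) := by
      intro x hx
      obtain ⟨h0, h1⟩ := hpos x hx
      have hl : Real.log x ≠ 0 := (Real.log_neg h0 h1).ne
      exact (continuousAt_id.mul ((continuousAt_const.div (continuousAt_id.mul
        (Real.continuousAt_log h0.ne')) (mul_ne_zero h0.ne' hl)).pow 2)).continuousWithinAt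
    have hint : IntegrableOn (fun x : ℝ => x * (-1 / (x * Real.log x)) ^ 2) (Icc a r) :=
      hcont.integrableOn_Icc
    have hftc := intervalIntegral.integral_eq_sub_of_hasDerivAt (a := a) (b := r)
      (f := fun x => -(Real.log x)⁻¹) (f' := fun x => x * (-1 / (x * Real.log x)) ^ 2)
      (fun x hx => by
        rw [uIcc_of_le ha.2.le] at hx
        exact hasDerivAt_neg_inv_log (hpos x hx).1 (hpos x hx).2)
      ((intervalIntegrable_iff_integrableOn_Icc_of_le ha.2.le).mpr hint)
    rw [intervalIntegral.integral_of_le ha.2.le, integral_Ioc_eq_integral_Ioo] at hftc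
    rw [← hftc, ofReal_integral_eq_lintegral_ofReal (hint.mono_set Ioo_subset_Icc_self)]
    · exact lintegral_mono_set (Ioo_subset_Ioo_left ha.1.le)
    · filter_upwards [ae_restrict_mem measurableSet_Ioo] with x hx
      exact mul_nonneg (ha.1.trans hx.1).le (sq_nonneg _)
  refine le_of_tendsto ?_ hbound
  refine ENNReal.tendsto_ofReal ?_
  have h := (Real.tendsto_log_nhdsGT_zero.inv_tendsto_atBot).neg.const_sub (-(Real.log r)⁻¹)
  simpa using h

/-- In polar coordinates the radial integrand is 1 / (x log² x), with primitive -1 / log x vanishing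
at 0. Only the lower bound is needed. -/
theorem le_puncturedDiskArea {r : ℝ} (hr : 0 < r) (hr1 : r < 1) :
    ENNReal.ofReal (2 * Real.pi * -(Real.log r)⁻¹) ≤ puncturedDiskArea (puncturedDisk r) := by
  have hmeas : MeasurableSet (puncturedDisk r) :=
    (isOpen_lt continuous_const continuous_norm).measurableSet.inter
      (isOpen_lt continuous_norm continuous_const).measurableSet
  rw [puncturedDiskArea, ← lintegral_indicator hmeas, ← Complex.lintegral_comp_polarCoord_symm]
  set f : ℝ → ℝ≥0∞ := fun x => ENNReal.ofReal (x * (-1 / (x * Real.log x)) ^ 2)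
  have hf : Measurable f := by fun_prop
  calc ENNReal.ofReal (2 * Real.pi * -(Real.log r)⁻¹)
      = ENNReal.ofReal (-(Real.log r)⁻¹) * ENNReal.ofReal (2 * Real.pi) := by
        rw [mul_comm, ENNReal.ofReal_mul' (by positivity)]
    _ ≤ (∫⁻ x in Ioo 0 r, f x) * ∫⁻ _ in Ioo (-Real.pi) Real.pi, 1 := by
        gcongr
        · exact ofReal_neg_inv_log_le_lintegral hr hr1
        · rw [setLIntegral_one, Real.volume_Ioo]
          exact ENNReal.ofReal_le_ofReal (by linarith)
    _ = ∫⁻ p in Ioo 0 r ×ˢ Ioo (-Real.pi) Real.pi, f p.1 * 1 := by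
        rw [Measure.volume_eq_prod, ← Measure.prod_restrict,
          lintegral_prod_mul hf.aemeasurable aemeasurable_const]
    _ ≤ ∫⁻ p in Ioo 0 r ×ˢ Ioo (-Real.pi) Real.pi, ENNReal.ofReal p.1 •
          (puncturedDisk r).indicator (fun z => ENNReal.ofReal (puncturedDiskDensity z ^ 2))
            (Complex.polarCoord.symm p) := by
        refine setLIntegral_mono' (measurableSet_Ioo.prod measurableSet_Ioo) fun p hp => ?_
        have hp0 : 0 < p.1 := hp.1.1
        have hn : ‖Complex.polarCoord.symm p‖ = p.1 := by
          rw [Complex.norm_polarCoord_symm, abs_of_pos hp0]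
        rw [indicator_of_mem (show _ ∈ puncturedDisk r by
          exact ⟨by rw [hn]; exact hp0, by rw [hn]; exact hp.1.2⟩), puncturedDiskDensity, hn,
          smul_eq_mul, mul_one, ← ENNReal.ofReal_mul hp0.le]
    _ ≤ _ := by
        refine lintegral_mono_set ?_
        rw [polarCoord_target]
        exact prod_mono Ioo_subset_Ioi_self subset_rfl

theorem one_le_puncturedDiskArea :
    1 ≤ puncturedDiskArea (puncturedDisk (Real.exp (-(2 * Real.pi)))) := by
  have hpi := Real.pi_pos
  have h := le_puncturedDiskArea (Real.exp_pos (-(2 * Real.pi)))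
    (Real.exp_lt_one_iff.mpr (by linarith))
  rwa [Real.log_exp, inv_neg, neg_neg, mul_inv_cancel₀ (by positivity), ENNReal.ofReal_one] at h

end Area

/-! ### The covering of the punctured disk and developing maps of cusps. -/

theorem norm_puncturedDiskCover (z : ℍ) :
    ‖puncturedDiskCover z‖ = Real.exp (-(2 * Real.pi * z.im)) := by
  rw [puncturedDiskCover, Complex.norm_exp]
  congr 1
  simp

theorem puncturedDiskCover_eq_iff {z w : ℍ} :
    puncturedDiskCover z = puncturedDiskCover w ↔ ∃ n : ℤ, (z : ℂ) = w + n := by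
  rw [puncturedDiskCover, puncturedDiskCover, Complex.exp_eq_exp_iff_exists_int]
  refine exists_congr fun n => ?_
  rw [show 2 * Real.pi * Complex.I * (w : ℂ) + n * (2 * Real.pi * Complex.I) =
    2 * Real.pi * Complex.I * (w + n) by ring]
  exact mul_right_inj' Complex.two_pi_I_ne_zero

theorem puncturedDiskCover_mem {z : ℍ} {r : ℝ} (hr : 0 < r) :
    puncturedDiskCover z ∈ puncturedDisk r ↔ -Real.log r / (2 * Real.pi) < z.im := by
  have hpi := Real.pi_pos
  have h : puncturedDiskCover z ∈ puncturedDisk r ↔ ‖puncturedDiskCover z‖ < r :=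
    ⟨fun h => h.2, fun h => ⟨norm_pos_iff.mpr (Complex.exp_ne_zero _), h⟩⟩
  rw [h, norm_puncturedDiskCover, ← Real.lt_log_iff_exp_lt hr, div_lt_iff₀ (by positivity)]
  constructor <;> intro h <;> linarith

theorem exists_puncturedDiskCover_eq {q : ℂ} {r : ℝ} (hr : r < 1) (hq : q ∈ puncturedDisk r) :
    ∃ z : ℍ, puncturedDiskCover z = q := by
  have hpi := Real.pi_pos
  have hq0 : q ≠ 0 := norm_pos_iff.mp hq.1
  have him : 0 < (Complex.log q / (2 * Real.pi * Complex.I)).im := by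
    have h1 : Complex.log q / (2 * Real.pi * Complex.I) =
        ((2 * Real.pi)⁻¹ : ℝ) * (-Complex.I * Complex.log q) := by
      rw [div_eq_mul_inv, mul_inv, Complex.inv_I]
      push_cast
      ring
    rw [h1, Complex.im_ofReal_mul]
    refine mul_pos (by positivity) ?_
    simpa [Complex.log_re] using Real.log_neg hq.1 (hq.2.trans hr)
  refine ⟨⟨_, him⟩, ?_⟩
  rw [puncturedDiskCover, coe_mk, mul_div_cancel₀ _ Complex.two_pi_I_ne_zero, Complex.exp_log hq0]

theorem isOpen_puncturedDisk (r : ℝ) : IsOpen (puncturedDisk r) :=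
  (isOpen_lt continuous_const continuous_norm).inter (isOpen_lt continuous_norm continuous_const)

theorem mdifferentiable_puncturedDiskCover : MDifferentiable 𝓘(ℂ) 𝓘(ℂ) puncturedDiskCover :=
  fun z => MDifferentiableAt.comp (I' := 𝓘(ℂ)) z
    (g := fun w : ℂ => Complex.exp (2 * Real.pi * Complex.I * w))
    ((Complex.differentiable_exp.comp
      (differentiable_id.const_mul (2 * Real.pi * Complex.I))) (z : ℂ)).mdifferentiableAt
    (mdifferentiable_coe z)

/-- The covering of the punctured disk has local holomorphic sections. -/
theorem exists_section_puncturedDiskCover (z : ℍ) :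
    ∃ s : ℂ → ℍ, s (puncturedDiskCover z) = z ∧
      MDifferentiableAt 𝓘(ℂ) 𝓘(ℂ) s (puncturedDiskCover z) ∧
      ∀ᶠ q in 𝓝 (puncturedDiskCover z), puncturedDiskCover (s q) = q := by
  have hq0 : puncturedDiskCover z ≠ 0 := Complex.exp_ne_zero _
  set q₀ := puncturedDiskCover z with hq₀
  set l : ℂ → ℂ := fun q => z + Complex.log (q / q₀) / (2 * Real.pi * Complex.I) with hl
  have hl0 : l q₀ = z := by simp [hl, div_self hq0]
  have hld : DifferentiableAt ℂ l q₀ := by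
    have h1 : DifferentiableAt ℂ (fun q => Complex.log (q / q₀)) q₀ := by
      refine DifferentiableAt.clog (differentiableAt_id.div_const _) ?_
      simp [div_self hq0]
    exact (h1.div_const _).const_add _
  have him : 0 < (l q₀).im := by rw [hl0]; exact z.im_pos
  refine ⟨fun q => ofComplex (l q), (congrArg ofComplex hl0).trans (ofComplex_apply z),
    (mdifferentiableAt_ofComplex him).comp q₀ hld.mdifferentiableAt, ?_⟩
  filter_upwards [(Complex.continuous_im.continuousAt.comp hld.continuousAt).eventually
    (lt_mem_nhds him), isOpen_ne.mem_nhds hq0] with q hq hqne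
  rw [puncturedDiskCover, ofComplex_apply_of_im_pos hq, coe_mk, hl, mul_add,
    mul_div_cancel₀ _ Complex.two_pi_I_ne_zero, Complex.exp_add,
    Complex.exp_log (div_ne_zero hqne hq0)]
  exact mul_div_cancel₀ _ hq0

namespace HorocyclicNhd

variable {S : Type*} [MetricSpace S] [ChartedSpace ℂ S]

/-- The map `F` is a developing map of the horocyclic neighbourhood above the height `Y`. -/
def IsDevelopedBy (U : HorocyclicNhd S) (F : ℍ → S) (Y : ℝ) : Prop :=
  ∀ z : ℍ, Y < z.im →
    puncturedDiskCover z ∈ puncturedDisk U.radius ∧ U.toFun (puncturedDiskCover z) = F z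

theorem exists_developing_map [IsManifold 𝓘(ℂ) ω S] [CompleteSpace S] (hS : IsHyperbolicMetric S)
    (U : HorocyclicNhd S) : ∃ (F : ℍ → S) (Y : ℝ), (∀ z, HolIsomAt F z) ∧
      (∀ z w, puncturedDiskCover z = puncturedDiskCover w → F z = F w) ∧
      U.IsDevelopedBy F Y := by
  have hpi := Real.pi_pos
  set Z := -Real.log U.radius / (2 * Real.pi) with hZ
  have hZ0 : 0 < Z :=
    div_pos (neg_pos.mpr (Real.log_neg U.radius_pos U.radius_lt_one)) (by positivity)
  have hmem : ∀ z : ℍ, Z < z.im → puncturedDiskCover z ∈ puncturedDisk U.radius := fun z hz =>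
    (puncturedDiskCover_mem U.radius_pos).mpr hz
  obtain ⟨F, hF, hFU⟩ := hS.exists_holIsomAt_extension (Z := Z) (Y := Z + 1)
    (F₀ := fun z => U.toFun (puncturedDiskCover z)) hZ0 (by linarith) (fun z hz =>
      ⟨U.local_isometry z (hmem z hz), by
        filter_upwards [continuous_im.continuousAt.eventually (lt_mem_nhds hz)] with w hw
        exact (U.holomorphic.mdifferentiableAt
          ((isOpen_puncturedDisk _).mem_nhds (hmem w hw))).comp w
            (mdifferentiable_puncturedDiskCover w)⟩)
  refine ⟨F, Z + 1, hF, fun z w hzw => ?_, fun z hz => ⟨hmem z (by linarith), (hFU z hz).symm⟩⟩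
  obtain ⟨n, hn⟩ := puncturedDiskCover_eq_iff.mp hzw
  have htr : ∀ u : ℍ, puncturedDiskCover (translation n • u) = puncturedDiskCover u := fun u =>
    puncturedDiskCover_eq_iff.mpr ⟨n, by rw [coe_translation_smul]; push_cast; rfl⟩
  have hz : z = translation n • w := by
    apply UpperHalfPlane.ext
    rw [hn, coe_translation_smul]; push_cast; rfl
  have him : ∀ u : ℍ, (translation n • u : ℍ).im = u.im := fun u => by
    have := congrArg Complex.im (coe_translation_smul n u)
    simpa using this
  set p : ℍ := ⟨⟨0, Z + 2⟩, by change (0 : ℝ) < Z + 2; linarith⟩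
  have hp : Z + 1 < p.im := by change Z + 1 < Z + 2; linarith
  rw [hz]
  -- Periodicity is clear high up, where F factors through the covering; the identity theorem
  -- carries it to all of `ℍ`.
  refine hS.eqOn_of_isPreconnected (F := fun u => F (translation n • u)) isPreconnected_univ
    (fun u _ => (hF _).comp (holIsomAt_smul _ u)) (fun u _ => hF u) (mem_univ p) ?_ (mem_univ w)
  filter_upwards [continuous_im.continuousAt.eventually (lt_mem_nhds hp)] with u hu
  rw [hFU _ (by rwa [him]), hFU u hu, htr]

/-- A map of `ℍ` which is locally isometric, invariant under integer translations and injective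
modulo these for large imaginary parts, induces a horocyclic neighbourhood. -/
theorem exists_isDevelopedBy {F : ℍ → S} (hF : ∀ z, HolIsomAt F z)
    (hT : ∀ z w, puncturedDiskCover z = puncturedDiskCover w → F z = F w)
    (hinj : ∀ z w : ℍ, 1 < z.im → 1 < w.im → F z = F w →
      puncturedDiskCover z = puncturedDiskCover w) :
    ∃ U : HorocyclicNhd S, U.radius = Real.exp (-(2 * Real.pi)) ∧ U.IsDevelopedBy F 1 := by
  classical
  have hpi := Real.pi_pos
  set r := Real.exp (-(2 * Real.pi)) with hr
  have hr0 : 0 < r := Real.exp_pos _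
  have hr1 : r < 1 := Real.exp_lt_one_iff.mpr (by linarith)
  have hmem : ∀ z : ℍ, puncturedDiskCover z ∈ puncturedDisk r ↔ 1 < z.im := fun z => by
    rw [puncturedDiskCover_mem hr0, hr, Real.log_exp, neg_neg, div_self (by positivity)]
  set f : ℂ → S := fun q => if h : ∃ z : ℍ, puncturedDiskCover z = q then F h.choose else F I with hf
  have hfc : ∀ z, f (puncturedDiskCover z) = F z := fun z => by
    have h : ∃ w : ℍ, puncturedDiskCover w = puncturedDiskCover z := ⟨z, rfl⟩
    simp only [hf, dif_pos h]
    exact hT _ _ h.choose_spec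
  refine ⟨⟨r, hr0, hr1, f, ?_, ?_, ?_⟩, rfl, fun z hz => ⟨(hmem z).mpr hz, hfc z⟩⟩
  · intro q hq q' hq' h
    obtain ⟨z, rfl⟩ := exists_puncturedDiskCover_eq hr1 hq
    obtain ⟨w, rfl⟩ := exists_puncturedDiskCover_eq hr1 hq'
    rw [hfc, hfc] at h
    exact hinj z w ((hmem z).mp hq) ((hmem w).mp hq') h
  · intro q hq
    obtain ⟨z, rfl⟩ := exists_puncturedDiskCover_eq hr1 hq
    obtain ⟨s, hs, hsd, hsq⟩ := exists_section_puncturedDiskCover z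
    refine MDifferentiableAt.mdifferentiableWithinAt ?_
    have h1 : MDifferentiableAt 𝓘(ℂ) 𝓘(ℂ) (fun q => F (s q)) (puncturedDiskCover z) :=
      MDifferentiableAt.comp (I' := 𝓘(ℂ)) _ (g := F) (hF _).mdifferentiableAt hsd
    refine h1.congr_of_eventuallyEq ?_
    filter_upwards [hsq] with q hq
    rw [← hfc, hq]
  · intro z _
    simp only [hfc]
    exact (hF z).isom

variable {U V : HorocyclicNhd S} {F G : ℍ → S} {Y Y' : ℝ} {g : SL(2, ℝ)}

/-- The restriction of a horocyclic neighbourhood to a smaller punctured disk. -/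
def restrict (U : HorocyclicNhd S) (r : ℝ) (hr : 0 < r) (hrU : r ≤ U.radius) : HorocyclicNhd S :=
  have hsub : puncturedDisk r ⊆ puncturedDisk U.radius := fun _ hq => ⟨hq.1, hq.2.trans_le hrU⟩
  { radius := r
    radius_pos := hr
    radius_lt_one := hrU.trans_lt U.radius_lt_one
    toFun := U.toFun
    injOn := U.injOn.mono hsub
    holomorphic := U.holomorphic.mono hsub
    local_isometry := fun z hz => U.local_isometry z (hsub hz) }

theorem im_smul_of_lower_left_eq_zero (hg : g 1 0 = 0) (z : ℍ) : (g • z).im = g 0 0 ^ 2 * z.im := by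
  have := congrArg Complex.im (coe_smul_of_lower_left_eq_zero hg z)
  simpa [← Complex.ofReal_pow, ← Complex.ofReal_mul] using this

theorem upper_left_sq_pos (hg : g 1 0 = 0) : 0 < g 0 0 ^ 2 := by
  have := sl_det_eq g
  rw [hg, mul_zero, sub_zero] at this
  exact sq_pos_of_ne_zero (left_ne_zero_of_mul_eq_one this)

/-- As g fixes ∞, it scales heights by a², a being its upper left entry. Points above max Y (Y' /
a²) are thus developed in both neighbourhoods, and shrinking U to them gives a common one. -/
theorem sameCusp_of_smul (hU : U.IsDevelopedBy F Y) (hV : V.IsDevelopedBy G Y')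
    (hg : g 1 0 = 0) (h : ∀ z, F z = G (g • z)) : U.SameCusp V := by
  have hpi := Real.pi_pos
  have ha := upper_left_sq_pos hg
  set t := max Y (Y' / g 0 0 ^ 2)
  set r := min U.radius (Real.exp (-(2 * Real.pi * t)))
  have hr : 0 < r := lt_min U.radius_pos (Real.exp_pos _)
  refine ⟨U.restrict r hr (min_le_left _ _), ?_⟩
  rintro _ ⟨q, hq, rfl⟩
  obtain ⟨z, rfl⟩ := exists_puncturedDiskCover_eq
    ((min_le_left _ _).trans_lt U.radius_lt_one) hq
  have hz : t < z.im := by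
    have h1 := hq.2.trans_le (min_le_right _ _)
    rw [norm_puncturedDiskCover, Real.exp_lt_exp] at h1
    nlinarith
  have h1 := hU z ((le_max_left _ _).trans_lt hz)
  have h2 := hV (g • z) (by
    rw [im_smul_of_lower_left_eq_zero hg]
    have := (le_max_right _ _).trans_lt hz
    rwa [div_lt_iff₀ ha, mul_comm] at this)
  refine ⟨⟨_, h1.1, rfl⟩, ⟨_, h2.1, ?_⟩⟩
  rw [h2.2, ← h, ← h1.2]
  rfl

/-- An isometry that fixes the point at infinity and preserves the developing map of a cusp is an
integer translation. -/
theorem puncturedDiskCover_smul (hU : U.IsDevelopedBy F Y) (hg : g 1 0 = 0)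
    (h : ∀ z, F z = F (g • z)) (z : ℍ) : puncturedDiskCover (g • z) = puncturedDiskCover z := by
  have ha := upper_left_sq_pos hg
  set t := max (max Y (Y / g 0 0 ^ 2)) 0 + 1
  have ht : 0 < t := by linarith [le_max_right (max Y (Y / g 0 0 ^ 2)) 0]
  have ht1 : Y < t := by
    linarith [le_max_left (max Y (Y / g 0 0 ^ 2)) 0, le_max_left Y (Y / g 0 0 ^ 2)]
  have ht2 : Y / g 0 0 ^ 2 < t := by
    linarith [le_max_left (max Y (Y / g 0 0 ^ 2)) 0, le_max_right Y (Y / g 0 0 ^ 2)]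
  set u : ℍ := ⟨⟨0, t⟩, ht⟩
  have hu : u.im = t := rfl
  have h1 := hU u ht1
  have h2 := hU (g • u) (by
    rw [im_smul_of_lower_left_eq_zero hg, hu]
    rwa [div_lt_iff₀ ha, mul_comm] at ht2)
  -- Both u and g u lie above Y, where U is embedded, so g u = u + n. Comparing heights gives a² =
  -- 1, and g is translation by n.
  have h3 := U.injOn h2.1 h1.1 (by rw [h2.2, h1.2, h u])
  obtain ⟨n, hn⟩ := puncturedDiskCover_eq_iff.mp h3
  have ha1 : g 0 0 ^ 2 = 1 := by
    have h4 := congrArg Complex.im hn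
    have h5 := im_smul_of_lower_left_eq_zero hg u
    simp only [Complex.add_im, Complex.intCast_im, add_zero, coe_im] at h4
    rw [h4] at h5
    have := u.im_pos
    exact mul_right_cancel₀ this.ne' (by linarith)
  have hac : (g 0 0 : ℂ) ^ 2 = 1 := by exact_mod_cast ha1
  rw [coe_smul_of_lower_left_eq_zero hg, hac, one_mul] at hn
  refine puncturedDiskCover_eq_iff.mpr ⟨n, ?_⟩
  rw [coe_smul_of_lower_left_eq_zero hg, hac, one_mul, add_left_cancel hn]

theorem exists_of_mem_carrier (hU : U.IsDevelopedBy F 1)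
    (hr : U.radius = Real.exp (-(2 * Real.pi))) {s : S} (hs : s ∈ U.carrier) :
    ∃ z : ℍ, 1 < z.im ∧ F z = s := by
  have hpi := Real.pi_pos
  obtain ⟨q, hq, rfl⟩ := hs
  obtain ⟨z, rfl⟩ := exists_puncturedDiskCover_eq U.radius_lt_one hq
  have hz : 1 < z.im := by
    rw [puncturedDiskCover_mem U.radius_pos, hr, Real.log_exp, neg_neg,
      div_self (by positivity)] at hq
    exact hq
  exact ⟨z, hz, (hU z hz).2.symm⟩

end HorocyclicNhd

theorem mainTheorem9 (S : Type*) [MetricSpace S] [ChartedSpace ℂ S] [IsManifold 𝓘(ℂ) ω S]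
    [ConnectedSpace S] [CompleteSpace S] (hS : IsHyperbolicMetric S) :
    CuspsAtLeast S 1 := by
  choose F Y hF hT hV using fun P : Cusp S =>
    HorocyclicNhd.exists_developing_map hS (Quot.out P)
  have htr : ∀ P z, F P (translation 1 • z) = F P z := fun P z =>
    hT P _ _ (puncturedDiskCover_eq_iff.mpr ⟨1, by rw [coe_translation_smul]; simp⟩)
  have hkey : ∀ P Q (z w : ℍ), 1 < z.im → 1 < w.im → F P z = F Q w →
      ∃ g : SL(2, ℝ), g • z = w ∧ (∀ u, F P u = F Q (g • u)) ∧ g 1 0 = 0 := by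
    intro P Q z w hz hw h
    obtain ⟨g, hgz, hg⟩ := hS.exists_smul_of_apply_eq (hF P) (hF Q) h
    exact ⟨g, hgz, hg, lower_left_eq_zero (hF Q) (htr P) (htr Q) hg hz (hgz ▸ hw)⟩
  choose U hUr hU using fun P => HorocyclicNhd.exists_isDevelopedBy (hF P) (hT P)
    (fun z w hz hw h => by
      obtain ⟨g, rfl, hg, hg0⟩ := hkey P P z w hz hw h
      exact (HorocyclicNhd.puncturedDiskCover_smul (hV P) hg0 hg z).symm)
  refine ⟨U, fun P => ?_, fun P Q hPQ => ?_, fun P => ?_⟩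
  -- The new neighbourhood and the chosen representative of P share the developing map `F P`, so the
  -- identity matrix relates them.
  · exact (Quot.sound (HorocyclicNhd.sameCusp_of_smul (hU P) (hV P) (g := 1) (by simp)
      (by simp))).trans (Quot.out_eq P)
  · rw [Set.disjoint_left]
    intro s hsP hsQ
    obtain ⟨z, hz, hzs⟩ := HorocyclicNhd.exists_of_mem_carrier (hU P) (hUr P) hsP
    obtain ⟨w, hw, hws⟩ := HorocyclicNhd.exists_of_mem_carrier (hU Q) (hUr Q) hsQ
    obtain ⟨g, -, hg, hg0⟩ := hkey P Q z w hz hw (hzs.trans hws.symm)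
    refine hPQ ?_
    rw [← Quot.out_eq P, ← Quot.out_eq Q]
    exact Quot.sound (HorocyclicNhd.sameCusp_of_smul (hV P) (hV Q) hg0 hg)
  · rw [HorocyclicNhd.area, hUr]
    exact one_le_puncturedDiskArea
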